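/- **Theorem 1.** Let $A\in\mathbb{R}^{d\times d}$ be symmetric positive definite (force matrix), $\Gamma\in\mathbb{R}^{d\times d}$ symmetric positive semidefinite (damping matrix), and $F:\mathbb{R}^d\to\mathbb{R}^d$ a continuous force. Let $d=m+k$ and let $\Phi\in\mathbb{R}^{d\times m}$, $\Psi\in\mathbb{R}^{d\times k}$ satisfy $\Phi^T\Phi=I$, $\Psi^T\Psi=I$, $\Phi^T\Psi=0$. Put $A_{12}=\Phi^TA\Psi=A_{21}^T$, $A_{22}=\Psi^TA\Psi$, $\Gamma_{11}=\Phi^T\Gamma\Phi$, $\Gamma_{12}=\Phi^T\Gamma\Psi=\Gamma_{21}^T$, $\Gamma_{22}=\Psi^T\Gamma\Psi$, $F_{\rm eff}(q)=\Phi^TF(\Phi q)-A_{12}A_{22}^{-1}A_{21}q$, and let $$\theta(t)=\begin{bmatrix}A_{12}&\Gamma_{12}\end{bmatrix}e^{-Gt}\begin{bmatrix}A_{22}^{-1}&0\\0&-I\end{bmatrix}\begin{bmatrix}A_{21}\\\Gamma_{21}\end{bmatrix},\qquad G=\begin{bmatrix}0&-I\\A_{22}&\Gamma_{22}\end{bmatrix},$$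 be the memory kernel of the exact coarse-grained equation. Assume that $\theta$ is integrable on $(0,\infty)$, put $M_0=\theta(0)$, $M_\infty=\int_0^\infty\theta(t)\,dt$, assume that $M_\infty$ is invertible, and let $$C=M_0,\qquad B=-M_0M_\infty^{-1}.$$ Let $k_BT>0$. Let $f_1=dW_1/dt$ and $\zeta=dW/dt$ be Gaussian white noises, where $W_1,W$ are Wiener processes in $\mathbb{R}^m$, with $\langle f_1(t)f_1(t')^T\rangle=2k_BT\,\Gamma_{11}\,\delta(t-t')$ and $\langle\zeta(t)\zeta(t')^T\rangle=\Sigma\,\delta(t-t')$, where $$\Sigma=-2k_BT\,CB^T=-2k_BT\,BC ,$$ and let $z(0)$ be Gaussian with mean zero and covariance $k_BT\,C$; assume that $z(0)$, $\zeta$ and $f_1$ are independent. Consider the first-order model $$\dot q=p,\qquad \dot p=F_{\rm eff}(q)-\Gamma_{11}p-z+f_1,\qquad \dot z=Bz+Cp+\zeta\qquad(t\ge0),$$ and let $g(t)=e^{Bt}z(0)+\int_0^te^{B(t-\tau)}\zeta(\tau)\,d\tau$. Then: 1. Almost surely, for all paths $q,p,z$ with the given value $z(0)$: $(q,p,z)$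 solves the first-order model if and only if $(q,p)$ solves the generalized Langevin equation $$\dot q=p,\qquad \dot p=F_{\rm eff}(q)-\Gamma_{11}p-\int_0^t\tilde\theta(t-\tau)p(\tau)\,d\tau+\hat f,\qquad \hat f=f_1-g,$$ in which the memory kernel $\theta$ is replaced by the approximation $\tilde\theta(t)=e^{Bt}C$, and $z(t)=\int_0^t\tilde\theta(t-\tau)p(\tau)\,d\tau+g(t)$ for all $t\ge0$. 2. The colored noise $g$ is a stationary Gaussian process with mean zero, and $\langle g(t)g(t')^T\rangle=k_BT\,e^{(t-t')B}C$ for $0\le t'\le t$. 3. The second fluctuation-dissipation theorem is preserved exactly: $\hat f$ is a Gaussian noise with mean zero and $$\langle\hat f(t)\hat f(t')^T\rangle=2k_BT\,\Gamma_{11}\,\delta(t-t')+k_BT\,\tilde\theta(t-t')$$ (where $\tilde\theta(-s)=\tilde\theta(s)^T$ for $s>0$), in the sense that $N(t)=\int_0^t\hat f$ is a Gaussian process with mean zero and $\langle N(s)N(t)^T\rangle=2k_BT\,\Gamma_{11}\min(s,t)+k_BT\int_0^s\!\int_0^t\tilde\theta(u-v)\,dv\,du$ for all $s,t\ge0$.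 -/

import Mathlib

open MeasureTheory ProbabilityTheory Set
open scoped NNReal Matrix

noncomputable section

namespace CoarseGrain

/-! ### The exact coarse-grained model

The full model is `ẋ = v`, `v̇ = F x - Γ v + f` in `ℝᵈ` (unit masses), with linearised force `-A x`
for the eliminated variables.  The columns of `Φ` are an orthonormal basis of the space of coarse
variables, and those of `Ψ` are an orthonormal basis of its orthogonal complement. -/

section Exact

variable {d m k : ℕ}

/-- The block matrix `G = [0, -I; A₂₂, Γ₂₂]`, where `A₂₂ = Ψᵀ A Ψ` and `Γ₂₂ = Ψᵀ Γ Ψ`. -/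
def matG (A Γ : Matrix (Fin d) (Fin d) ℝ) (Ψ : Matrix (Fin d) (Fin k) ℝ) :
    Matrix (Fin k ⊕ Fin k) (Fin k ⊕ Fin k) ℝ :=
  Matrix.fromBlocks 0 (-1) (Ψᵀ * A * Ψ) (Ψᵀ * Γ * Ψ)

/-- The exact memory kernel
`θ(t) = [A₁₂, Γ₁₂] e^{-Gt} [A₂₂⁻¹, 0; 0, -I] [A₂₁; Γ₂₁]`. -/
def memoryKernel (A Γ : Matrix (Fin d) (Fin d) ℝ) (Φ : Matrix (Fin d) (Fin m) ℝ)
    (Ψ : Matrix (Fin d) (Fin k) ℝ) (t : ℝ) : Matrix (Fin m) (Fin m) ℝ :=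
  (Matrix.fromCols (Φᵀ * A * Ψ) (Φᵀ * Γ * Ψ) : Matrix (Fin m) (Fin k ⊕ Fin k) ℝ) *
    NormedSpace.exp (-(t • matG A Γ Ψ)) *
    (Matrix.fromBlocks (Ψᵀ * A * Ψ)⁻¹ 0 0 (-1) : Matrix (Fin k ⊕ Fin k) (Fin k ⊕ Fin k) ℝ) *
    Matrix.fromRows (Ψᵀ * A * Φ) (Ψᵀ * Γ * Φ)

/-- The moment `M₀ = θ(0)`. -/
def momentZero (A Γ : Matrix (Fin d) (Fin d) ℝ) (Φ : Matrix (Fin d) (Fin m) ℝ)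
    (Ψ : Matrix (Fin d) (Fin k) ℝ) : Matrix (Fin m) (Fin m) ℝ :=
  memoryKernel A Γ Φ Ψ 0

/-- The moment `M_∞ = ∫₀^∞ θ(t) dt` (entrywise integral). -/
def momentInfty (A Γ : Matrix (Fin d) (Fin d) ℝ) (Φ : Matrix (Fin d) (Fin m) ℝ)
    (Ψ : Matrix (Fin d) (Fin k) ℝ) : Matrix (Fin m) (Fin m) ℝ :=
  Matrix.of fun i j => ∫ t in Ioi (0 : ℝ), memoryKernel A Γ Φ Ψ t i j

/-- The effective force `F_eff(q) = Φᵀ F(Φ q) - A₁₂ A₂₂⁻¹ A₂₁ q`. -/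
def effectiveForce (F : (Fin d → ℝ) → (Fin d → ℝ)) (A : Matrix (Fin d) (Fin d) ℝ)
    (Φ : Matrix (Fin d) (Fin m) ℝ) (Ψ : Matrix (Fin d) (Fin k) ℝ) (q : Fin m → ℝ) : Fin m → ℝ :=
  Φᵀ *ᵥ F (Φ *ᵥ q) - ((Φᵀ * A * Ψ) * (Ψᵀ * A * Ψ)⁻¹ * (Ψᵀ * A * Φ)) *ᵥ q

end Exact

/-! ### Noises

A (generalised) noise `f` on `[0, ∞)` is represented by its time integral `N(t) = ∫₀ᵗ f`. -/

section Noise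

variable {m : ℕ} {Ω : Type*} [MeasurableSpace Ω]

/-- The two-time correlation determined by a kernel `K` given for nonnegative lags:
`K(u - v)` for `v ≤ u`, and the transpose `K(v - u)ᵀ` for `u < v`. -/
def twoTime (K : ℝ → Matrix (Fin m) (Fin m) ℝ) (u v : ℝ) : Matrix (Fin m) (Fin m) ℝ :=
  if v ≤ u then K (u - v) else (K (v - u))ᵀ

/-- The noise `f = dN/dt` has correlation `⟨f(t) f(t')ᵀ⟩ = D δ(t - t') + K(t - t')`.  Integrating
over `[0, s] × [0, t]`, this is the identity
`⟨N(s) N(t)ᵀ⟩ = min(s, t) D + ∫₀ˢ ∫₀ᵗ K(u - v) dv du`, for all `s, t ≥ 0`. -/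
def HasNoiseCorrelation (N : ℝ → Ω → Fin m → ℝ) (D : Matrix (Fin m) (Fin m) ℝ)
    (K : ℝ → Matrix (Fin m) (Fin m) ℝ) (μ : Measure Ω) : Prop :=
  ∀ s t : ℝ, 0 ≤ s → 0 ≤ t → ∀ i j : Fin m,
    cov[fun ω => N s ω i, fun ω => N t ω j; μ] =
      min s t * D i j + ∫ u in (0 : ℝ)..s, ∫ v in (0 : ℝ)..t, twoTime K u v i j

/-- `X` restricted to times `t ≥ 0` is a Gaussian process with mean zero. -/
structure IsCenteredGaussian (X : ℝ → Ω → Fin m → ℝ) (μ : Measure Ω) : Prop where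
  gaussian : IsGaussianProcess (fun t : ℝ≥0 => X t) μ
  mean : ∀ t : ℝ, 0 ≤ t → ∀ i, ∫ ω, X t ω i ∂μ = 0

/-- `W` is a Wiener process on `[0, ∞)` with covariance matrix `S`, that is, `dW/dt` is Gaussian
white noise with correlation `S δ(t - t')`. -/
structure IsWiener (W : ℝ → Ω → Fin m → ℝ) (S : Matrix (Fin m) (Fin m) ℝ) (μ : Measure Ω) :
    Prop extends IsCenteredGaussian W μ where
  start : ∀ᵐ ω ∂μ, W 0 ω = 0
  corr : HasNoiseCorrelation W S (fun _ => 0) μ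
  cont : ∀ᵐ ω ∂μ, ContinuousOn (fun t => W t ω) (Ici 0)

/-- `X` is (strictly) stationary on `[0, ∞)`: its finite-dimensional laws are invariant under
time shifts. -/
def IsStationary (X : ℝ → Ω → Fin m → ℝ) (μ : Measure Ω) : Prop :=
  ∀ h : ℝ≥0, ∀ I : Finset ℝ≥0,
    μ.map (fun ω (t : I) => X ((t : ℝ≥0) + h : ℝ≥0) ω) = μ.map (fun ω (t : I) => X (t : ℝ≥0) ω)

/-- The Wiener integral `∫₀ᵗ φ(τ) dw(τ)` along a continuous path `w` of a deterministic
continuously differentiable matrix function `φ`, through integration by parts: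
`φ(t) w(t) - φ(0) w(0) - ∫₀ᵗ φ'(τ) w(τ) dτ`, with the entrywise derivative of `φ`. -/
def wienerIntegral (φ : ℝ → Matrix (Fin m) (Fin m) ℝ) (w : ℝ → Fin m → ℝ) (t : ℝ) : Fin m → ℝ :=
  φ t *ᵥ w t - φ 0 *ᵥ w 0 -
    ∫ τ in (0 : ℝ)..t, (Matrix.of fun i j => deriv (fun s => φ s i j) τ) *ᵥ w τ

/-- The colored noise `g(t) = e^{Bt} z(0) + ∫₀ᵗ e^{B(t-τ)} ζ(τ) dτ`, where `ζ = dW/dt`. -/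
def coloredNoise (B : Matrix (Fin m) (Fin m) ℝ) (z₀ : Ω → Fin m → ℝ) (W : ℝ → Ω → Fin m → ℝ)
    (t : ℝ) (ω : Ω) : Fin m → ℝ :=
  NormedSpace.exp (t • B) *ᵥ z₀ ω +
    wienerIntegral (fun τ => NormedSpace.exp ((t - τ) • B)) (fun τ => W τ ω) t

/-- The time integral of the noise `f₁ - g`, where `f₁ = dW₁/dt`. -/
def totalNoise (W₁ g : ℝ → Ω → Fin m → ℝ) (t : ℝ) (ω : Ω) : Fin m → ℝ :=
  W₁ t ω - ∫ s in (0 : ℝ)..t, g s ω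

end Noise

/-! ### The two stochastic models, path by path

The noises are additive, so the stochastic differential equations are integral equations that
hold along each path. -/

section Models

variable {m : ℕ}

/-- The memory term `∫₀ᵗ K(t - τ) p(τ) dτ`. -/
def memoryTerm (K : ℝ → Matrix (Fin m) (Fin m) ℝ) (p : ℝ → Fin m → ℝ) (t : ℝ) : Fin m → ℝ :=
  ∫ τ in (0 : ℝ)..t, K (t - τ) *ᵥ p τ

/-- The generalized Langevin equation `q̇ = p`,
`ṗ = Feff(q) - Γ₁₁ p - ∫₀ᵗ K(t - τ) p(τ) dτ + f` on `[0, ∞)`, where `f = dn/dt`. -/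
structure SolvesGLE (Feff : (Fin m → ℝ) → (Fin m → ℝ)) (Γ₁₁ : Matrix (Fin m) (Fin m) ℝ)
    (K : ℝ → Matrix (Fin m) (Fin m) ℝ) (n : ℝ → Fin m → ℝ) (q p : ℝ → Fin m → ℝ) : Prop where
  cont_q : ContinuousOn q (Ici 0)
  cont_p : ContinuousOn p (Ici 0)
  eq_q : ∀ t, 0 ≤ t → q t = q 0 + ∫ s in (0 : ℝ)..t, p s
  eq_p : ∀ t, 0 ≤ t →
    p t = p 0 + (∫ s in (0 : ℝ)..t, (Feff (q s) - Γ₁₁ *ᵥ p s - memoryTerm K p s)) + n t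

/-- The first-order model `q̇ = p`, `ṗ = Feff(q) - Γ₁₁ p - z + f₁`, `ż = B z + C p + ζ`
on `[0, ∞)`, where `f₁ = dw₁/dt` and `ζ = dw/dt`. -/
structure SolvesFirstOrder (Feff : (Fin m → ℝ) → (Fin m → ℝ))
    (Γ₁₁ B C : Matrix (Fin m) (Fin m) ℝ) (w₁ w : ℝ → Fin m → ℝ)
    (q p z : ℝ → Fin m → ℝ) : Prop where
  cont_q : ContinuousOn q (Ici 0)
  cont_p : ContinuousOn p (Ici 0)
  cont_z : ContinuousOn z (Ici 0)
  eq_q : ∀ t, 0 ≤ t → q t = q 0 + ∫ s in (0 : ℝ)..t, p s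
  eq_p : ∀ t, 0 ≤ t →
    p t = p 0 + (∫ s in (0 : ℝ)..t, (Feff (q s) - Γ₁₁ *ᵥ p s - z s)) + w₁ t
  eq_z : ∀ t, 0 ≤ t → z t = z 0 + (∫ s in (0 : ℝ)..t, (B *ᵥ z s + C *ᵥ p s)) + w t

end Models

end CoarseGrain

end

/-!
The result rests on three facts.

*Algebra.*  With `J = diag(A₂₂⁻¹, -I)` the matrix `G J` is symmetric, hence so is
`θ(t) = [A₁₂, Γ₁₂] e^{-tG} J [A₁₂, Γ₁₂]ᵀ`, and with it `M₀` and `M_∞`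
(`memoryKernel_transpose`).  Therefore `B C = C Bᵀ` (`mul_eq_mul_transpose_of_moments`), so that
`e^{tB} C` is symmetric and the covariance `Σ = -2 kBT C Bᵀ` of the driving noise satisfies the
Lyapunov equation `B (kBT C) + (kBT C) Bᵀ + Σ = 0`.

*Pathwise analysis.*  Along a continuous path of `W`, the colored noise is
`g(t) = e^{tB} (z(0) + M(t))` with `M(t) = ∫₀ᵗ e^{-sB} dW(s)` integrated by parts
(`coloredNoise_eq`).  Variation of constants for `z - W` shows that the equation for `z` is
equivalent to `z = ∫ e^{(t-τ)B} C p(τ) dτ + g`, and inserting this into the equation for `p`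
exchanges the first-order model and the generalized Langevin equation (`solvesFirstOrder_iff`).

*Gaussian calculus.*  All the random variables live in a linear space of centered Gaussian
variables: the span of the coordinates of the independent data `z(0)`, `W`, `W₁`, enlarged by almost
sure limits.  Such limits are again Gaussian (`IsCenteredNormal.of_tendsto`), and the time integrals
that define `M`, `g` and the integrated noise are limits of Riemann sums
(`integral_mem_aeLimits`).  Fubini's theorem (`IsGaussianSpace.covariance_integral`) reduces every
covariance to `⟨W(s) W(t)ᵀ⟩ = min(s, t) Σ`.  The Lyapunov equation gives
`⟨M(t) M(s)ᵀ⟩ = kBT (e^{-2sB} C - C)` for `s ≤ t`, whence `⟨g(t) g(s)ᵀ⟩ = kBT e^{(t-s)B} C`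
(`IsDrivenNoise.covariance_coloredNoise`).  This depends on `t - s` only, which is stationarity, and
integrated over a rectangle it is the fluctuation-dissipation theorem, the cross terms with `W₁`
being zero.
-/

namespace CoarseGrain

open Filter Topology

/-! ### Gaussian spaces -/

section CoordSpan

variable {Ω T : Type*} {m : ℕ}

/-- The linear span of the coordinates of a vector-valued process. -/
def coordSpan (X : T → Ω → Fin m → ℝ) : Submodule ℝ (Ω → ℝ) :=
  Submodule.span ℝ (range fun p : T × Fin m => fun ω => X p.1 ω p.2)

lemma coord_mem_coordSpan (X : T → Ω → Fin m → ℝ) (t : T) (i : Fin m) :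
    (fun ω => X t ω i) ∈ coordSpan X :=
  Submodule.subset_span ⟨(t, i), rfl⟩

lemma exists_measurable_of_mem_coordSpan {X : T → Ω → Fin m → ℝ} {Y : Ω → ℝ}
    (hY : Y ∈ coordSpan X) :
    ∃ φ : (T → Fin m → ℝ) → ℝ, Measurable φ ∧ Y = φ ∘ fun ω t => X t ω := by
  induction hY using Submodule.span_induction with
  | mem Y hY =>
    obtain ⟨p, rfl⟩ := hY
    exact ⟨fun x => x p.1 p.2, by fun_prop, rfl⟩
  | zero => exact ⟨fun _ => 0, by fun_prop, rfl⟩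
  | add Y Z _ _ hY hZ =>
    obtain ⟨φ, hφ, rfl⟩ := hY
    obtain ⟨ψ, hψ, rfl⟩ := hZ
    exact ⟨fun x => φ x + ψ x, by fun_prop, rfl⟩
  | smul c Y _ hY =>
    obtain ⟨φ, hφ, rfl⟩ := hY
    exact ⟨fun x => c • φ x, by fun_prop, rfl⟩

/-- A linear functional of finitely many values of a process is a linear combination of their
coordinates. -/
lemma exists_dual_comp_eq_sum {I : Type*} [Fintype I] (L : (I → Fin m → ℝ) →L[ℝ] ℝ) :
    ∃ c : I × Fin m → ℝ, ∀ x : I → Fin m → ℝ, L x = ∑ p, c p * x p.1 p.2 := by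
  classical
  refine ⟨fun p => L (Pi.single p.1 (Pi.single p.2 1)), fun x => ?_⟩
  rw [Fintype.sum_prod_type]
  conv_lhs => rw [← Finset.univ_sum_single x, map_sum]
  refine Finset.sum_congr rfl fun t _ => ?_
  have h : Pi.single t (x t)
      = ∑ i, x t i • (Pi.single t (Pi.single i 1) : I → Fin m → ℝ) := by
    conv_lhs => rw [pi_eq_sum_univ' (x t)]
    rw [← LinearMap.single_apply ℝ, map_sum]
    simp [LinearMap.single_apply]
  rw [h, map_sum]
  exact Finset.sum_congr rfl fun i _ => by rw [map_smul, smul_eq_mul, mul_comm]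

lemma sum_mul_mem {V : Submodule ℝ (Ω → ℝ)} {ι : Type*} [Fintype ι] (c : ι → ℝ)
    {Y : ι → Ω → ℝ} (hY : ∀ k, Y k ∈ V) :
    (fun ω => ∑ k, c k * Y k ω) ∈ V := by
  have h : (fun ω => ∑ k, c k * Y k ω) = ∑ k, c k • Y k := by
    funext ω
    simp
  rw [h]
  exact V.sum_mem fun k _ => V.smul_mem _ (hY k)

end CoordSpan

section GaussianSpace

variable {Ω : Type*} [MeasurableSpace Ω] {μ : Measure Ω}

/-- A centered Gaussian random variable, possibly degenerate: its law is `N(0, v)` for some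
`v ≥ 0`. -/
def IsCenteredNormal (X : Ω → ℝ) (μ : Measure Ω) : Prop :=
  ∃ v : ℝ≥0, HasLaw X (gaussianReal 0 v) μ

namespace IsCenteredNormal

variable {X Y : Ω → ℝ}

lemma aemeasurable (hX : IsCenteredNormal X μ) : AEMeasurable X μ := hX.choose_spec.aemeasurable

lemma integral_eq_zero (hX : IsCenteredNormal X μ) : ∫ ω, X ω ∂μ = 0 := by
  obtain ⟨v, hv⟩ := hX
  rw [hv.integral_eq, integral_id_gaussianReal]

lemma hasGaussianLaw (hX : IsCenteredNormal X μ) : HasGaussianLaw X μ := by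
  obtain ⟨v, hv⟩ := hX
  exact ⟨by rw [hv.map_eq]; infer_instance⟩

lemma memLp_two (hX : IsCenteredNormal X μ) : MemLp X 2 μ := hX.hasGaussianLaw.memLp_two

lemma of_hasGaussianLaw (hX : HasGaussianLaw X μ) (h0 : ∫ ω, X ω ∂μ = 0) :
    IsCenteredNormal X μ :=
  ⟨Var[X; μ].toNNReal, hX.aemeasurable, by rw [hX.map_eq_gaussianReal, h0]⟩

lemma add_of_indepFun (hX : IsCenteredNormal X μ) (hY : IsCenteredNormal Y μ)
    (h : IndepFun X Y μ) : IsCenteredNormal (X + Y) μ := by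
  obtain ⟨v, hv⟩ := hX
  obtain ⟨w, hw⟩ := hY
  refine ⟨v + w, hv.aemeasurable.add hw.aemeasurable, ?_⟩
  simpa using gaussianReal_add_gaussianReal_of_indepFun h hv.map_eq hw.map_eq

/-- An almost sure limit of centered Gaussian variables is centered Gaussian.  The characteristic
functions `exp(-vₙ s² / 2)` converge; the limit is nonzero at some `s ≠ 0`, which forces the
variances `vₙ` to converge. -/
lemma of_tendsto [IsProbabilityMeasure μ] {X : ℕ → Ω → ℝ} (hX : ∀ n, IsCenteredNormal (X n) μ)
    (h : ∀ᵐ ω ∂μ, Tendsto (fun n => X n ω) atTop (𝓝 (Y ω))) : IsCenteredNormal Y μ := by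
  choose v hv using hX
  have hYm : AEMeasurable Y μ :=
    aemeasurable_of_tendsto_metrizable_ae atTop (fun n => (hv n).aemeasurable) h
  have hcf : ∀ s : ℝ, Tendsto (fun n => ((Real.exp (-(v n * s ^ 2 / 2)) : ℝ) : ℂ)) atTop
      (𝓝 (charFun (μ.map Y) s)) := by
    intro s
    have h1 : ∀ n, ((Real.exp (-(v n * s ^ 2 / 2)) : ℝ) : ℂ)
        = ∫ ω, Complex.exp (s * X n ω * Complex.I) ∂μ := by
      intro n
      have := charFun_gaussianReal (μ := 0) (v := v n) s
      rw [← (hv n).map_eq, charFun_apply_real, integral_map (hv n).aemeasurable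
        (by fun_prop)] at this
      rw [this]
      push_cast
      simp
    rw [charFun_apply_real, integral_map hYm (by fun_prop)]
    simp_rw [h1]
    refine tendsto_integral_of_dominated_convergence (fun _ => 1) (fun n => ?_)
      (integrable_const 1) (fun n => ae_of_all _ fun ω => ?_) ?_
    · have := (hv n).aemeasurable
      exact AEMeasurable.aestronglyMeasurable (by fun_prop)
    · rw [← Complex.ofReal_mul, Complex.norm_exp_ofReal_mul_I]
    · filter_upwards [h] with ω hω
      have hc : Continuous fun x : ℝ => Complex.exp (s * x * Complex.I) := by fun_prop
      exact (hc.tendsto (Y ω)).comp hω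
  have : IsProbabilityMeasure (μ.map Y) := Measure.isProbabilityMeasure_map hYm
  obtain ⟨s, hs, hsne⟩ : ∃ s : ℝ, s ≠ 0 ∧ charFun (μ.map Y) s ≠ 0 := by
    have h0 : charFun (μ.map Y) 0 ≠ 0 := by simp
    have hn := (continuous_charFun (μ := μ.map Y)).continuousAt.eventually_ne h0
    have := (hn.filter_mono nhdsWithin_le_nhds).and (self_mem_nhdsWithin (s := {0}ᶜ) (a := (0 : ℝ)))
    obtain ⟨s, h1, h2⟩ := this.exists
    exact ⟨s, h2, h1⟩
  have hre : Tendsto (fun n => Real.exp (-(v n * s ^ 2 / 2))) atTop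
      (𝓝 ‖charFun (μ.map Y) s‖) := by
    refine (hcf s).norm.congr fun n => ?_
    rw [Complex.norm_real, Real.norm_of_nonneg (Real.exp_pos _).le]
  have hlog := (Real.continuousAt_log (norm_ne_zero_iff.2 hsne)).tendsto.comp hre
  have hvlim : ∃ c : ℝ, Tendsto (fun n => (v n : ℝ)) atTop (𝓝 c) := by
    refine ⟨_, (hlog.const_mul (-(2 / s ^ 2))).congr fun n => ?_⟩
    simp only [Function.comp, Real.log_exp]
    field_simp
  obtain ⟨c, hc⟩ := hvlim
  lift c to ℝ≥0 using ge_of_tendsto' hc fun n => (v n).2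
  refine ⟨c, hYm, Measure.ext_of_charFun ?_⟩
  funext t
  refine tendsto_nhds_unique (hcf t) ?_
  rw [charFun_gaussianReal]
  have h2 : Continuous fun c : ℝ => ((Real.exp (-(c * t ^ 2 / 2)) : ℝ) : ℂ) := by fun_prop
  convert! (h2.tendsto c).comp hc using 2
  push_cast
  simp

end IsCenteredNormal

/-- A linear space of random variables that are all centered Gaussian.  Finite families of its
elements are then jointly Gaussian. -/
def IsGaussianSpace (V : Submodule ℝ (Ω → ℝ)) (μ : Measure Ω) : Prop :=
  ∀ X ∈ V, IsCenteredNormal X μ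

/-- The almost sure limits of sequences in `V`. -/
def aeLimits (V : Submodule ℝ (Ω → ℝ)) (μ : Measure Ω) : Submodule ℝ (Ω → ℝ) where
  carrier := {Y | ∃ X : ℕ → Ω → ℝ, (∀ n, X n ∈ V) ∧
    ∀ᵐ ω ∂μ, Tendsto (fun n => X n ω) atTop (𝓝 (Y ω))}
  zero_mem' := ⟨fun _ => 0, fun _ => V.zero_mem, by simp⟩
  add_mem' := by
    rintro _ _ ⟨X, hX, hXl⟩ ⟨Y, hY, hYl⟩
    refine ⟨fun n => X n + Y n, fun n => V.add_mem (hX n) (hY n), ?_⟩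
    filter_upwards [hXl, hYl] with ω h1 h2 using h1.add h2
  smul_mem' := by
    rintro c _ ⟨X, hX, hXl⟩
    refine ⟨fun n => c • X n, fun n => V.smul_mem c (hX n), ?_⟩
    filter_upwards [hXl] with ω h1 using h1.const_smul c

variable {V : Submodule ℝ (Ω → ℝ)}

lemma IsGaussianSpace.aeLimits [IsProbabilityMeasure μ] (hV : IsGaussianSpace V μ) :
    IsGaussianSpace (aeLimits V μ) μ := by
  rintro Y ⟨X, hX, hXl⟩
  exact .of_tendsto (fun n => hV _ (hX n)) hXl

lemma mem_aeLimits_of_ae_eq {X Y : Ω → ℝ} (hX : X ∈ V) (h : X =ᵐ[μ] Y) : Y ∈ aeLimits V μ := by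
  refine ⟨fun _ => X, fun _ => hX, ?_⟩
  filter_upwards [h] with ω hω
  simp [hω]

lemma le_aeLimits : V ≤ aeLimits V μ := fun _ hX => mem_aeLimits_of_ae_eq hX .rfl

/-- Left Riemann sums of a continuous function converge to its integral. -/
lemma tendsto_riemannSum {f : ℝ → ℝ} {T : ℝ} (hT : 0 ≤ T) (hf : ContinuousOn f (Ici 0)) :
    Tendsto (fun n : ℕ => ∑ k ∈ Finset.range (n + 1), T / (n + 1) * f (k * (T / (n + 1)))) atTop
      (𝓝 (∫ s in (0 : ℝ)..T, f s)) := by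
  have hfT : ContinuousOn f (Icc 0 T) := hf.mono Icc_subset_Ici_self
  have huc := isCompact_Icc.uniformContinuousOn_of_continuous hfT
  rw [Metric.tendsto_atTop]
  intro ε hε
  obtain ⟨δ, hδ, hfδ⟩ := Metric.uniformContinuousOn_iff.1 huc (ε / (T + 1)) (by positivity)
  obtain ⟨N, hN⟩ := exists_nat_gt (T / δ)
  refine ⟨N, fun n hn => ?_⟩
  set h : ℝ := T / (n + 1) with hh
  have hn0 : (0 : ℝ) < n + 1 := by positivity
  have hh0 : 0 ≤ h := by positivity
  have hhn : (n + 1) * h = T := by rw [hh]; field_simp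
  have hhδ : h < δ := by
    rw [hh, div_lt_iff₀ hn0]
    have h1 : T < N * δ := (div_lt_iff₀ hδ).1 hN
    have h2 : (N : ℝ) ≤ n := by exact_mod_cast hn
    nlinarith
  have hle : ∀ k ∈ Finset.range (n + 1), (k + 1 : ℝ) * h ≤ T := by
    intro k hk
    have : (k : ℝ) + 1 ≤ n + 1 := by
      have := Finset.mem_range.1 hk
      exact_mod_cast this
    calc (k + 1 : ℝ) * h ≤ (n + 1) * h := by gcongr
      _ = T := hhn
  have hint : ∀ k ∈ Finset.range (n + 1),
      IntervalIntegrable f volume (k * h) ((k + 1 : ℕ) * h) := by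
    intro k hk
    refine (hf.mono ?_).intervalIntegrable
    rw [uIcc_of_le (by push_cast; nlinarith)]
    intro x hx
    exact (show (0 : ℝ) ≤ k * h by positivity).trans hx.1
  have hsum := intervalIntegral.sum_integral_adjacent_intervals (f := f) (μ := volume)
    (a := fun k : ℕ => (k : ℝ) * h) (n := n + 1) (fun k hk => hint k (Finset.mem_range.2 hk))
  simp only [Nat.cast_zero, zero_mul] at hsum
  rw [show ((n + 1 : ℕ) : ℝ) * h = T by push_cast; exact hhn] at hsum
  rw [← hsum, dist_eq_norm, ← Finset.sum_sub_distrib]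
  have hterm : ∀ k ∈ Finset.range (n + 1),
      ‖h * f (k * h) - ∫ x in (k * h)..((k + 1 : ℕ) * h), f x‖ ≤ ε / (T + 1) * h := by
    intro k hk
    have h1 : h * f (k * h) - ∫ x in (k * h)..((k + 1 : ℕ) * h), f x
        = ∫ x in (k * h)..((k + 1 : ℕ) * h), (f (k * h) - f x) := by
      rw [intervalIntegral.integral_sub (by simp) (hint k hk)]
      simp only [intervalIntegral.integral_const, smul_eq_mul]
      push_cast
      ring
    rw [h1]
    refine (intervalIntegral.norm_integral_le_of_norm_le_const (C := ε / (T + 1))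
      fun x hx => ?_).trans_eq ?_
    · rw [uIoc_of_le (by push_cast; nlinarith)] at hx
      have hk0 : (0 : ℝ) ≤ k * h := by positivity
      have hx2 : x ≤ (k + 1) * h := by simpa using hx.2
      have hkT := hle k hk
      rw [← dist_eq_norm]
      refine (hfδ _ ⟨hk0, by nlinarith⟩ _ ⟨hk0.trans hx.1.le, hx2.trans hkT⟩ ?_).le
      rw [dist_comm, Real.dist_eq, abs_of_nonneg (by linarith [hx.1])]
      nlinarith
    · rw [show ((k + 1 : ℕ) : ℝ) * h - k * h = h by push_cast; ring, abs_of_nonneg hh0]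
  calc _ ≤ ∑ k ∈ Finset.range (n + 1), ε / (T + 1) * h :=
        (norm_sum_le _ _).trans (Finset.sum_le_sum hterm)
    _ = ε * (T / (T + 1)) := by
        rw [Finset.sum_const, Finset.card_range, nsmul_eq_mul, ← hhn]
        push_cast
        ring
    _ < ε := by
        have : T / (T + 1) < 1 := by rw [div_lt_one (by positivity)]; linarith
        nlinarith

/-- Integrals of an almost surely continuous process with values in `V` are limits of Riemann
sums, which lie in `V`. -/
lemma integral_mem_aeLimits {Y : ℝ → Ω → ℝ} {Z : Ω → ℝ} {T : ℝ} (hT : 0 ≤ T)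
    (hY : ∀ s, 0 ≤ s → Y s ∈ V) (hc : ∀ᵐ ω ∂μ, ContinuousOn (fun s => Y s ω) (Ici 0))
    (hZ : ∀ᵐ ω ∂μ, Z ω = ∫ s in (0 : ℝ)..T, Y s ω) : Z ∈ aeLimits V μ := by
  refine ⟨fun n => ∑ k ∈ Finset.range (n + 1), (T / (n + 1)) • Y (k * (T / (n + 1))),
    fun n => V.sum_mem fun k _ => V.smul_mem _ (hY _ (by positivity)), ?_⟩
  filter_upwards [hc, hZ] with ω h1 h2
  rw [h2]
  simpa [Finset.sum_apply] using tendsto_riemannSum hT h1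

lemma IsGaussianSpace.sup {V₁ V₂ : Submodule ℝ (Ω → ℝ)} (h₁ : IsGaussianSpace V₁ μ)
    (h₂ : IsGaussianSpace V₂ μ) (h : ∀ X ∈ V₁, ∀ Y ∈ V₂, IndepFun X Y μ) :
    IsGaussianSpace (V₁ ⊔ V₂) μ := by
  intro Z hZ
  obtain ⟨X, hX, Y, hY, rfl⟩ := Submodule.mem_sup.1 hZ
  exact (h₁ X hX).add_of_indepFun (h₂ Y hY) (h X hX Y hY)

lemma aeLimits_congr {X Y : Ω → ℝ} (hX : X ∈ CoarseGrain.aeLimits V μ) (h : X =ᵐ[μ] Y) :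
    Y ∈ CoarseGrain.aeLimits V μ := by
  obtain ⟨Z, hZ, hZX⟩ := hX
  refine ⟨Z, hZ, ?_⟩
  filter_upwards [hZX, h] with ω h1 h2
  rwa [← h2]

variable {m : ℕ} {T : Type*}

lemma IsGaussianSpace.aemeasurable_pi (hV : IsGaussianSpace V μ) {I : Type*} [Countable I]
    {X : I → Ω → Fin m → ℝ} (hX : ∀ t i, (fun ω => X t ω i) ∈ V) :
    AEMeasurable (fun ω t => X t ω) μ :=
  aemeasurable_pi_lambda _ fun t => aemeasurable_pi_lambda _ fun i => (hV _ (hX t i)).aemeasurable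

/-- A process is Gaussian if its coordinates belong to a common Gaussian space. -/
lemma IsGaussianSpace.isGaussianProcess (hV : IsGaussianSpace V μ)
    {X : T → Ω → Fin m → ℝ} (hX : ∀ t i, (fun ω => X t ω i) ∈ V) : IsGaussianProcess X μ where
  hasGaussianLaw I := by
    have hm := hV.aemeasurable_pi (I := I) (X := fun t => X t) fun t i => hX t i
    refine ⟨isGaussian_of_map_eq_gaussianReal fun L => ?_⟩
    obtain ⟨c, hc⟩ := exists_dual_comp_eq_sum L
    obtain ⟨v, hv⟩ := hV _ (sum_mul_mem c fun p : I × Fin m => hX p.1 p.2)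
    refine ⟨0, v, ?_⟩
    rw [← hv.map_eq]
    refine (AEMeasurable.map_map_of_aemeasurable (by fun_prop) hm).trans ?_
    congr 1
    funext ω
    exact hc _

lemma isGaussianSpace_coordSpan {X : T → Ω → Fin m → ℝ} (hX : IsGaussianProcess X μ)
    (h0 : ∀ t i, ∫ ω, X t ω i ∂μ = 0) : IsGaussianSpace (coordSpan X) μ := by
  classical
  have := hX.isProbabilityMeasure
  intro Y hY
  obtain ⟨c, rfl⟩ := Finsupp.mem_span_range_iff_exists_finsupp.1 hY
  refine .of_hasGaussianLaw ?_ ?_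
  · let I : Finset T := c.support.image Prod.fst
    let L : (I → Fin m → ℝ) →L[ℝ] ℝ := ∑ p : c.support,
      c p • (ContinuousLinearMap.proj (R := ℝ) (φ := fun _ : Fin m => ℝ) p.1.2).comp
        (ContinuousLinearMap.proj (R := ℝ) (φ := fun _ : I => Fin m → ℝ)
          ⟨p.1.1, Finset.mem_image_of_mem _ p.2⟩)
    convert! (hX.hasGaussianLaw I).map L using 1
    funext ω
    simp only [Finsupp.sum, Finset.sum_apply, Pi.smul_apply, L, Function.comp,
      sum_apply, smul_apply]
    rw [← Finset.sum_coe_sort]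
    rfl
  · simp only [Finsupp.sum, Finset.sum_apply, Pi.smul_apply, smul_eq_mul]
    rw [integral_finsetSum]
    · exact Finset.sum_eq_zero fun p _ => by rw [integral_const_mul, h0, mul_zero]
    · intro p _
      have h := (hX.hasGaussianLaw_eval p.1).map
        (ContinuousLinearMap.proj (R := ℝ) (φ := fun _ : Fin m => ℝ) p.2)
      exact h.integrable.const_mul _

end GaussianSpace

/-! ### Covariances with time integrals -/

section Covariance

variable {Ω : Type*} [MeasurableSpace Ω] {μ : Measure Ω} {X Y Z : Ω → ℝ}

lemma IsCenteredNormal.covariance_eq [IsProbabilityMeasure μ] (hX : IsCenteredNormal X μ)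
    (hY : IsCenteredNormal Y μ) : cov[X, Y; μ] = ∫ ω, X ω * Y ω ∂μ := by
  rw [covariance_eq_sub hX.memLp_two hY.memLp_two, hX.integral_eq_zero]
  simp

lemma covariance_sum_mul_right [IsProbabilityMeasure μ] {ι : Type*} [Fintype ι] (c : ι → ℝ)
    {Y : ι → Ω → ℝ} (hX : IsCenteredNormal X μ) (hY : ∀ k, IsCenteredNormal (Y k) μ) :
    cov[X, fun ω => ∑ k, c k * Y k ω; μ] = ∑ k, c k * cov[X, Y k; μ] := by
  rw [covariance_fun_sum_right (fun k => (hY k).memLp_two.const_mul (c k)) hX.memLp_two]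
  simp only [covariance_const_mul_right]

lemma covariance_congr_ae {X' Y' : Ω → ℝ} (hX : X =ᵐ[μ] X') (hY : Y =ᵐ[μ] Y') :
    cov[X, Y; μ] = cov[X', Y'; μ] := by
  rw [covariance, covariance, integral_congr_ae hX, integral_congr_ae hY]
  refine integral_congr_ae ?_
  filter_upwards [hX, hY] with ω h1 h2
  rw [h1, h2]

/-- The joint law of finitely many values of a centered Gaussian process is determined by the
covariances. -/
lemma IsGaussianSpace.map_eq_map [IsProbabilityMeasure μ] {V : Submodule ℝ (Ω → ℝ)}
    (hV : IsGaussianSpace V μ) {m : ℕ} {I : Type*} [Fintype I] {X Y : I → Ω → Fin m → ℝ}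
    (hX : ∀ t i, (fun ω => X t ω i) ∈ V) (hY : ∀ t i, (fun ω => Y t ω i) ∈ V)
    (h : ∀ s t i j, cov[fun ω => X s ω i, fun ω => X t ω j; μ]
      = cov[fun ω => Y s ω i, fun ω => Y t ω j; μ]) :
    μ.map (fun ω t => X t ω) = μ.map (fun ω t => Y t ω) := by
  have hXm := hV.aemeasurable_pi hX
  have hYm := hV.aemeasurable_pi hY
  have := Measure.isProbabilityMeasure_map hXm
  have := Measure.isProbabilityMeasure_map hYm
  refine Measure.ext_of_charFunDual (funext fun L => ?_)
  obtain ⟨c, hc⟩ := exists_dual_comp_eq_sum L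
  have hvar : ∀ {Z : I → Ω → Fin m → ℝ}, (∀ t i, (fun ω => Z t ω i) ∈ V) →
      Var[fun ω => ∑ p : I × Fin m, c p * Z p.1 ω p.2; μ] = ∑ p : I × Fin m, c p *
        ∑ q : I × Fin m, c q * cov[fun ω => Z p.1 ω p.2, fun ω => Z q.1 ω q.2; μ] := by
    intro Z hZ
    have hS := hV _ (sum_mul_mem c fun p : I × Fin m => hZ p.1 p.2)
    rw [← covariance_self hS.aemeasurable,
      covariance_sum_mul_right c hS fun p => hV _ (hZ p.1 p.2)]
    refine Finset.sum_congr rfl fun p _ => ?_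
    rw [covariance_comm, covariance_sum_mul_right c (hV _ (hZ p.1 p.2)) fun q => hV _ (hZ q.1 q.2)]
  have hlaw : ∀ {Z : I → Ω → Fin m → ℝ}, (∀ t i, (fun ω => Z t ω i) ∈ V) →
      (μ.map fun ω t => Z t ω).map L
        = gaussianReal 0 Var[fun ω => ∑ p : I × Fin m, c p * Z p.1 ω p.2; μ].toNNReal := by
    intro Z hZ
    have hS := hV _ (sum_mul_mem c fun p : I × Fin m => hZ p.1 p.2)
    rw [AEMeasurable.map_map_of_aemeasurable (by fun_prop) (hV.aemeasurable_pi hZ),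
      show L ∘ (fun ω t => Z t ω) = fun ω => ∑ p : I × Fin m, c p * Z p.1 ω p.2 from
        funext fun ω => hc _, hS.hasGaussianLaw.map_eq_gaussianReal, hS.integral_eq_zero]
  rw [charFunDual_eq_charFun_map_one, charFunDual_eq_charFun_map_one, hlaw hX, hlaw hY, hvar hX,
    hvar hY]
  simp only [h]

/-- A process with almost surely continuous paths is jointly measurable up to null sets: it is the
limit of its values at the times `⌊n s⌋ / n`, which are countable in number. -/
lemma aestronglyMeasurable_uncurry {Y : ℝ → Ω → ℝ} {T : ℝ}
    (hY : ∀ s, 0 ≤ s → AEMeasurable (Y s) μ)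
    (hc : ∀ᵐ ω ∂μ, ContinuousOn (fun s => Y s ω) (Ici 0)) [SFinite μ] :
    AEStronglyMeasurable (fun p : Ω × ℝ => Y p.2 p.1)
      (μ.prod (volume.restrict (Ioc 0 T))) := by
  let Y' : ℕ → ℕ → Ω → ℝ := fun n k => (hY ((k : ℝ) / (n + 1)) (by positivity)).mk _
  have hY' : ∀ᵐ ω ∂μ, ∀ n k : ℕ, Y ((k : ℝ) / (n + 1)) ω = Y' n k ω :=
    ae_all_iff.2 fun n => ae_all_iff.2 fun k =>
      (hY ((k : ℝ) / (n + 1)) (by positivity)).ae_eq_mk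
  refine aestronglyMeasurable_of_tendsto_ae atTop
    (f := fun n p => Y' n ⌊p.2 * (n + 1 : ℝ)⌋₊ p.1) (fun n => ?_) ?_
  · have h1 : Measurable fun q : Ω × ℕ => Y' n q.2 q.1 :=
      measurable_from_prod_countable_left fun k =>
        (hY ((k : ℝ) / (n + 1)) (by positivity)).measurable_mk
    have h2 : Measurable fun p : Ω × ℝ => (p.1, ⌊p.2 * (n + 1 : ℝ)⌋₊) :=
      measurable_fst.prodMk (Nat.measurable_floor.comp (by fun_prop))
    exact (h1.comp h2).aestronglyMeasurable
  · have hfst := Measure.quasiMeasurePreserving_fst (μ := μ)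
      (ν := volume.restrict (Ioc (0 : ℝ) T)) |>.ae (hc.and hY')
    have hsnd := Measure.quasiMeasurePreserving_snd (μ := μ)
      (ν := volume.restrict (Ioc (0 : ℝ) T)) |>.ae (ae_restrict_mem measurableSet_Ioc)
    filter_upwards [hfst, hsnd] with p hp1 hp2
    obtain ⟨hcont, heq⟩ := hp1
    simp_rw [← heq]
    have hp0 : (0 : ℝ) ≤ p.2 := hp2.1.le
    have hlim : Tendsto (fun n : ℕ => (⌊p.2 * (n + 1 : ℝ)⌋₊ : ℝ) / (n + 1)) atTop (𝓝 p.2) := by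
      have := (tendsto_nat_floor_mul_div_atTop hp0).comp
        (tendsto_natCast_atTop_atTop.comp (tendsto_add_atTop_nat 1))
      simpa [Function.comp_def] using this
    refine (hcont p.2 hp0).tendsto.comp (tendsto_nhdsWithin_iff.2 ⟨hlim, ?_⟩)
    exact .of_forall fun n => by simp only [mem_Ici]; positivity

/-- Fubini's theorem for the covariance of `X` with the time integral `Z` of a Gaussian process of
bounded variance. -/
lemma IsGaussianSpace.covariance_integral [IsProbabilityMeasure μ] {V : Submodule ℝ (Ω → ℝ)}
    (hV : IsGaussianSpace V μ) {Y : ℝ → Ω → ℝ} {T M : ℝ} (hT : 0 ≤ T) (hX : X ∈ V)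
    (hY : ∀ s, 0 ≤ s → Y s ∈ V) (hc : ∀ᵐ ω ∂μ, ContinuousOn (fun s => Y s ω) (Ici 0))
    (hM : ∀ s, 0 ≤ s → s ≤ T → cov[Y s, Y s; μ] ≤ M) (hZV : Z ∈ V)
    (hZ : ∀ᵐ ω ∂μ, Z ω = ∫ s in (0 : ℝ)..T, Y s ω) :
    cov[X, Z; μ] = ∫ s in (0 : ℝ)..T, cov[X, Y s; μ] := by
  have hX2 := (hV X hX).memLp_two
  have hY2 : ∀ s, 0 ≤ s → MemLp (Y s) 2 μ := fun s hs => (hV _ (hY s hs)).memLp_two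
  have hjoint : AEStronglyMeasurable (fun p : Ω × ℝ => X p.1 * Y p.2 p.1)
      (μ.prod (volume.restrict (Ioc 0 T))) :=
    (hX2.aestronglyMeasurable.comp_fst).mul
      (aestronglyMeasurable_uncurry (fun s hs => (hV _ (hY s hs)).aemeasurable) hc)
  have hXY : ∀ s, 0 ≤ s → Integrable (fun ω => X ω * Y s ω) μ := fun s hs =>
    hX2.integrable_mul (hY2 s hs)
  have hprod : Integrable (Function.uncurry fun (ω : Ω) (s : ℝ) => X ω * Y s ω)
      (μ.prod (volume.restrict (Ioc 0 T))) := by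
    refine (integrable_prod_iff' hjoint).2 ⟨?_, ?_⟩
    · filter_upwards [ae_restrict_mem measurableSet_Ioc] with s hs using hXY s hs.1.le
    · refine Integrable.of_bound (C := ((∫ ω, X ω * X ω ∂μ) + M) / 2)
        hjoint.norm.prod_swap.integral_prod_right' ?_
      filter_upwards [ae_restrict_mem measurableSet_Ioc] with s hs
      have hs0 := hs.1.le
      rw [Real.norm_of_nonneg (integral_nonneg fun ω => norm_nonneg _)]
      have hXX : Integrable (fun ω => X ω * X ω) μ := hX2.integrable_mul hX2
      have hYY : Integrable (fun ω => Y s ω * Y s ω) μ := (hY2 s hs0).integrable_mul (hY2 s hs0)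
      calc ∫ ω, ‖X ω * Y s ω‖ ∂μ ≤ ∫ ω, (X ω * X ω + Y s ω * Y s ω) / 2 ∂μ := by
            refine integral_mono (hXY s hs0).norm ((hXX.add hYY).div_const 2) fun ω => ?_
            simp only [Real.norm_eq_abs, abs_mul]
            nlinarith [sq_nonneg (|X ω| - |Y s ω|), sq_abs (X ω), sq_abs (Y s ω)]
        _ = ((∫ ω, X ω * X ω ∂μ) + cov[Y s, Y s; μ]) / 2 := by
            rw [integral_div, integral_add hXX hYY,
              (hV _ (hY s hs0)).covariance_eq (hV _ (hY s hs0))]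
        _ ≤ _ := by
            have := hM s hs0 hs.2
            linarith
  have hswap := integral_integral_swap hprod
  calc cov[X, Z; μ] = ∫ ω, X ω * Z ω ∂μ := (hV X hX).covariance_eq (hV Z hZV)
    _ = ∫ ω, (∫ s in Ioc 0 T, X ω * Y s ω) ∂μ := by
        refine integral_congr_ae ?_
        filter_upwards [hZ] with ω hω
        rw [hω, intervalIntegral.integral_of_le hT, integral_const_mul]
    _ = ∫ s in (0 : ℝ)..T, ∫ ω, X ω * Y s ω ∂μ := by
        rw [hswap, intervalIntegral.integral_of_le hT]
    _ = _ := by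
        refine intervalIntegral.integral_congr fun s hs => ?_
        rw [uIcc_of_le hT] at hs
        exact ((hV X hX).covariance_eq (hV _ (hY s hs.1))).symm

end Covariance

/-! ### Linear differential equations with additive forcing -/

section Flow

variable {m : ℕ}

/-- The flow `e^{tB}` of the linear equation `ẏ = B y`. -/
noncomputable def flow (B : Matrix (Fin m) (Fin m) ℝ) (t : ℝ) : Matrix (Fin m) (Fin m) ℝ :=
  NormedSpace.exp (t • B)

variable (B : Matrix (Fin m) (Fin m) ℝ)

lemma flow_zero : flow B 0 = 1 := by simp [flow]

lemma flow_add (s t : ℝ) : flow B (s + t) = flow B s * flow B t := by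
  rw [flow, add_smul]
  exact Matrix.exp_add_of_commute _ _ (((Commute.refl B).smul_left s).smul_right t)

lemma flow_mul_flow_neg (t : ℝ) : flow B t * flow B (-t) = 1 := by
  rw [← flow_add, add_neg_cancel, flow_zero]

section

attribute [local instance] Matrix.linftyOpNormedRing Matrix.linftyOpNormedAlgebra

lemma semiconjBy_flow {n : Type*} [Fintype n] [DecidableEq n] {X Y Z : Matrix n n ℝ}
    (h : SemiconjBy X Y Z) (t : ℝ) :
    SemiconjBy X (NormedSpace.exp (t • Y)) (NormedSpace.exp (t • Z)) := by
  refine SemiconjBy.exp_right ?_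
  rw [SemiconjBy, mul_smul_comm, smul_mul_assoc, h.eq]

lemma commute_flow (t : ℝ) : Commute B (flow B t) := semiconjBy_flow (Commute.refl B) t

lemma hasDerivAt_flow_apply (t : ℝ) (i j : Fin m) :
    HasDerivAt (fun t => flow B t i j) ((B * flow B t) i j) t := by
  have h := hasDerivAt_exp_smul_const' (𝕂 := ℝ) B t
  exact ((Matrix.entryLinearMap ℝ ℝ i j).toContinuousLinearMap.hasFDerivAt.comp_hasDerivAt t h)

end

lemma hasDerivAt_flow_neg_apply (t : ℝ) (i j : Fin m) :
    HasDerivAt (fun t => flow B (-t) i j) (-(B * flow B (-t)) i j) t := by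
  have h := (hasDerivAt_flow_apply B (-t) i j).comp t (hasDerivAt_neg t)
  rwa [mul_neg_one] at h

@[fun_prop]
lemma continuous_flow : Continuous (flow B) :=
  continuous_matrix fun i j => continuous_iff_continuousAt.2 fun t =>
    (hasDerivAt_flow_apply B t i j).continuousAt

variable {B}

lemma hasDerivAt_mulVec {A : ℝ → Matrix (Fin m) (Fin m) ℝ} {A' : Matrix (Fin m) (Fin m) ℝ}
    {f : ℝ → Fin m → ℝ} {f' : Fin m → ℝ} {t : ℝ}
    (hA : ∀ i j, HasDerivAt (fun t => A t i j) (A' i j) t) (hf : HasDerivAt f f' t) :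
    HasDerivAt (fun t => A t *ᵥ f t) (A' *ᵥ f t + A t *ᵥ f') t := by
  refine hasDerivAt_pi.2 fun i => ?_
  have h := HasDerivAt.fun_sum (u := Finset.univ) fun j _ => (hA i j).mul (hasDerivAt_pi.1 hf j)
  simpa [Matrix.mulVec, dotProduct, Finset.sum_add_distrib] using h

lemma hasDerivAt_flow_mulVec {f : ℝ → Fin m → ℝ} {f' : Fin m → ℝ} {t : ℝ}
    (hf : HasDerivAt f f' t) :
    HasDerivAt (fun t => flow B t *ᵥ f t) (B *ᵥ (flow B t *ᵥ f t) + flow B t *ᵥ f') t := by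
  rw [Matrix.mulVec_mulVec]
  exact hasDerivAt_mulVec (hasDerivAt_flow_apply B t) hf

lemma hasDerivAt_flow_neg_mulVec {f : ℝ → Fin m → ℝ} {f' : Fin m → ℝ} {t : ℝ}
    (hf : HasDerivAt f f' t) :
    HasDerivAt (fun t => flow B (-t) *ᵥ f t) (flow B (-t) *ᵥ (f' - B *ᵥ f t)) t := by
  convert hasDerivAt_mulVec (A' := -(B * flow B (-t)))
    (fun i j => by simpa using hasDerivAt_flow_neg_apply B t i j) hf using 1
  rw [Matrix.mulVec_sub, Matrix.mulVec_mulVec, (commute_flow B (-t)).eq, Matrix.neg_mulVec]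
  abel

lemma mulVec_intervalIntegral (A : Matrix (Fin m) (Fin m) ℝ) {f : ℝ → Fin m → ℝ} {a b : ℝ}
    (hf : IntervalIntegrable f volume a b) :
    A *ᵥ (∫ s in a..b, f s) = ∫ s in a..b, A *ᵥ f s :=
  ((Matrix.mulVecLin A).toContinuousLinearMap.intervalIntegral_comp_comm hf).symm

lemma intervalIntegral_apply {f : ℝ → Fin m → ℝ} {a b : ℝ}
    (hf : IntervalIntegrable f volume a b) (i : Fin m) :
    (∫ s in a..b, f s) i = ∫ s in a..b, f s i :=
  ((ContinuousLinearMap.proj (R := ℝ) (φ := fun _ : Fin m => ℝ) i).intervalIntegral_comp_comm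
    hf).symm

lemma intervalIntegrable_of_continuousOn {f : ℝ → Fin m → ℝ} (hf : ContinuousOn f (Ici 0)) {t : ℝ}
    (ht : 0 ≤ t) : IntervalIntegrable f volume 0 t :=
  (hf.mono (by rw [uIcc_of_le ht]; exact Icc_subset_Ici_self)).intervalIntegrable

@[fun_prop]
lemma _root_.ContinuousOn.matrix_mulVec {A : ℝ → Matrix (Fin m) (Fin m) ℝ} {f : ℝ → Fin m → ℝ}
    {s : Set ℝ} (hA : ContinuousOn A s) (hf : ContinuousOn f s) :
    ContinuousOn (fun t => A t *ᵥ f t) s :=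
  (continuous_fst.matrix_mulVec continuous_snd).comp_continuousOn (hA.prodMk hf)

/-- Extending a function on `[0, ∞)` by its value at `0` turns one-sided statements about its
primitive into two-sided ones. -/
lemma continuous_comp_max {f : ℝ → Fin m → ℝ} (hf : ContinuousOn f (Ici 0)) :
    Continuous fun s => f (max s 0) :=
  hf.comp_continuous (by fun_prop) fun s => le_max_right s 0

lemma integral_comp_max (f : ℝ → Fin m → ℝ) {t : ℝ} (ht : 0 ≤ t) :
    ∫ s in (0 : ℝ)..t, f (max s 0) = ∫ s in (0 : ℝ)..t, f s := by
  refine intervalIntegral.integral_congr fun s hs => ?_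
  rw [uIcc_of_le ht] at hs
  simp only [max_eq_left hs.1]

/-- Variation of constants: the solution of the integral equation `y = y₀ + ∫ (B y + r)`. -/
lemma linear_ode_iff {r y : ℝ → Fin m → ℝ} (hr : ContinuousOn r (Ici 0)) (y₀ : Fin m → ℝ) :
    (ContinuousOn y (Ici 0) ∧ ∀ t, 0 ≤ t → y t = y₀ + ∫ s in (0 : ℝ)..t, (B *ᵥ y s + r s)) ↔
      ∀ t, 0 ≤ t → y t = flow B t *ᵥ (y₀ + ∫ s in (0 : ℝ)..t, flow B (-s) *ᵥ r s) := by
  constructor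
  · rintro ⟨hy, heq⟩ t ht
    have hc := continuous_comp_max (f := fun s => B *ᵥ y s + r s) (by fun_prop)
    let F : ℝ → Fin m → ℝ := fun t => y₀ + ∫ s in (0 : ℝ)..t, (B *ᵥ y (max s 0) + r (max s 0))
    have hF : ∀ s, 0 ≤ s → F s = y s := fun s hs => by
      rw [heq s hs, ← integral_comp_max _ hs]
    have hF' : ∀ s ∈ uIcc 0 t, HasDerivAt (fun s => flow B (-s) *ᵥ F s) (flow B (-s) *ᵥ r s) s := by
      intro s hs
      rw [uIcc_of_le ht] at hs
      convert hasDerivAt_flow_neg_mulVec (B := B)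
        ((hc.integral_hasStrictDerivAt 0 s).hasDerivAt.const_add y₀) using 2
      change _ = _ - B *ᵥ F s
      rw [hF s hs.1, max_eq_left hs.1]
      abel
    have hint := intervalIntegral.integral_eq_sub_of_hasDerivAt hF'
      (intervalIntegrable_of_continuousOn (by fun_prop) ht)
    rw [hint, hF t ht, hF 0 le_rfl, heq 0 le_rfl]
    simp only [neg_zero, flow_zero, Matrix.one_mulVec, intervalIntegral.integral_same, add_zero,
      add_sub_cancel, Matrix.mulVec_mulVec, flow_mul_flow_neg]
  · intro heq
    have hc := continuous_comp_max (f := fun s => flow B (-s) *ᵥ r s) (by fun_prop)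
    let H : ℝ → Fin m → ℝ := fun t =>
      flow B t *ᵥ (y₀ + ∫ s in (0 : ℝ)..t, flow B (-(max s 0)) *ᵥ r (max s 0))
    have hH : ∀ s, 0 ≤ s → H s = y s := fun s hs => by
      rw [heq s hs, ← integral_comp_max _ hs]
    have hH' : ∀ s, 0 ≤ s → HasDerivAt H (B *ᵥ y s + r s) s := by
      intro s hs
      convert hasDerivAt_flow_mulVec (B := B)
        ((hc.integral_hasStrictDerivAt 0 s).hasDerivAt.const_add y₀) using 1
      change _ = B *ᵥ H s + _
      rw [hH s hs, max_eq_left hs, Matrix.mulVec_mulVec, flow_mul_flow_neg, Matrix.one_mulVec]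
    have hy : ContinuousOn y (Ici 0) := by
      have : ContinuousOn H (Ici 0) := fun s hs => (hH' s hs).continuousAt.continuousWithinAt
      exact this.congr fun s hs => (hH s hs).symm
    refine ⟨hy, fun t ht => ?_⟩
    have hint := intervalIntegral.integral_eq_sub_of_hasDerivAt (a := 0) (b := t)
      (fun s hs => hH' s (by rw [uIcc_of_le ht] at hs; exact hs.1))
      (intervalIntegrable_of_continuousOn (by fun_prop) ht)
    rw [hint, hH t ht]
    simp [H, flow_zero]

end Flow

/-! ### The colored noise and the elimination of the auxiliary variable, path by path -/

section Pathwise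

variable {m : ℕ} {B C : Matrix (Fin m) (Fin m) ℝ} {w : ℝ → Fin m → ℝ}

/-- The Wiener integral `∫₀ᵗ e^{-sB} dw(s)` along a path with `w 0 = 0`, integrated by parts. -/
noncomputable def flowIntegral (B : Matrix (Fin m) (Fin m) ℝ) (w : ℝ → Fin m → ℝ) (t : ℝ) :
    Fin m → ℝ :=
  flow B (-t) *ᵥ w t + ∫ s in (0 : ℝ)..t, flow B (-s) *ᵥ (B *ᵥ w s)

lemma continuousOn_primitive {f : ℝ → Fin m → ℝ} (hf : ContinuousOn f (Ici 0)) :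
    ContinuousOn (fun t => ∫ s in (0 : ℝ)..t, f s) (Ici 0) := by
  have h : Continuous fun t => ∫ s in (0 : ℝ)..t, f (max s 0) :=
    continuous_iff_continuousAt.2 fun t =>
      ((continuous_comp_max hf).integral_hasStrictDerivAt 0 t).hasDerivAt.continuousAt
  exact h.continuousOn.congr fun t ht => (integral_comp_max f ht).symm

lemma continuousOn_flowIntegral (hw : ContinuousOn w (Ici 0)) :
    ContinuousOn (flowIntegral B w) (Ici 0) := by
  refine ContinuousOn.add (by fun_prop) (continuousOn_primitive (by fun_prop))

lemma coloredNoise_eq {Ω : Type*} {z₀ : Ω → Fin m → ℝ} {W : ℝ → Ω → Fin m → ℝ} {ω : Ω}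
    (hw : ContinuousOn (fun t => W t ω) (Ici 0)) (h0 : W 0 ω = 0) {t : ℝ} (ht : 0 ≤ t) :
    coloredNoise B z₀ W t ω = flow B t *ᵥ (z₀ ω + flowIntegral B (fun t => W t ω) t) := by
  have hd : ∀ τ, (Matrix.of fun i j => deriv (fun s => flow B (t - s) i j) τ)
      = -(flow B t * (flow B (-τ) * B)) := by
    intro τ
    ext i j
    have h := (hasDerivAt_flow_apply B (t - τ) i j).scomp τ ((hasDerivAt_id τ).const_sub t)
    rw [Matrix.of_apply]
    refine h.deriv.trans ?_
    rw [← mul_assoc, ← flow_add, ← sub_eq_add_neg, (commute_flow B (t - τ)).eq]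
    simp
  have hint : ∫ τ in (0 : ℝ)..t,
      (Matrix.of fun i j => deriv (fun s => flow B (t - s) i j) τ) *ᵥ W τ ω
      = -(flow B t *ᵥ ∫ s in (0 : ℝ)..t, flow B (-s) *ᵥ (B *ᵥ W s ω)) := by
    rw [mulVec_intervalIntegral _ (intervalIntegrable_of_continuousOn (by fun_prop) ht),
      ← intervalIntegral.integral_neg]
    refine intervalIntegral.integral_congr fun τ _ => ?_
    simp only [hd, Matrix.neg_mulVec, Matrix.mulVec_mulVec]
  unfold coloredNoise wienerIntegral flowIntegral
  change flow B t *ᵥ z₀ ω + (flow B (t - t) *ᵥ W t ω - flow B (t - 0) *ᵥ W 0 ω -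
    ∫ τ in (0 : ℝ)..t, (Matrix.of fun i j => deriv (fun s => flow B (t - s) i j) τ) *ᵥ W τ ω) = _
  rw [hint, h0]
  simp only [Matrix.mulVec_add, Matrix.mulVec_mulVec, flow_mul_flow_neg, sub_self, flow_zero,
    Matrix.one_mulVec, Matrix.mulVec_zero]
  abel

lemma memoryTerm_flow_eq {p : ℝ → Fin m → ℝ} (hp : ContinuousOn p (Ici 0)) {t : ℝ} (ht : 0 ≤ t) :
    memoryTerm (fun t => flow B t * C) p t
      = flow B t *ᵥ ∫ s in (0 : ℝ)..t, flow B (-s) *ᵥ (C *ᵥ p s) := by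
  rw [mulVec_intervalIntegral _ (intervalIntegrable_of_continuousOn (by fun_prop) ht)]
  refine intervalIntegral.integral_congr fun τ _ => ?_
  simp only [Matrix.mulVec_mulVec, sub_eq_add_neg, flow_add, mul_assoc]

lemma continuousOn_memoryTerm {p : ℝ → Fin m → ℝ} (hp : ContinuousOn p (Ici 0)) :
    ContinuousOn (memoryTerm (fun t => flow B t * C) p) (Ici 0) := by
  have h : ContinuousOn (fun t => flow B t *ᵥ ∫ s in (0 : ℝ)..t, flow B (-s) *ᵥ (C *ᵥ p s))
      (Ici 0) :=
    (continuous_flow B).continuousOn.matrix_mulVec (continuousOn_primitive (by fun_prop))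
  exact h.congr fun t ht => memoryTerm_flow_eq hp ht

/-- Solving the equation `ż = B z + C p + ζ` for the auxiliary variable, by variation of constants
for `z - w`, where `ζ = dw/dt`. -/
lemma auxiliary_equation_iff (hw : ContinuousOn w (Ici 0)) {p z : ℝ → Fin m → ℝ}
    (hp : ContinuousOn p (Ici 0)) :
    (ContinuousOn z (Ici 0) ∧
        ∀ t, 0 ≤ t → z t = z 0 + (∫ s in (0 : ℝ)..t, (B *ᵥ z s + C *ᵥ p s)) + w t) ↔
      ∀ t, 0 ≤ t → z t = memoryTerm (fun t => flow B t * C) p t +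
        flow B t *ᵥ (z 0 + flowIntegral B w t) := by
  have key := linear_ode_iff (B := B) (r := fun s => C *ᵥ p s + B *ᵥ w s)
    (y := fun t => z t - w t) (by fun_prop) (z 0)
  have hcont : ContinuousOn (fun t => z t - w t) (Ici 0) ↔ ContinuousOn z (Ici 0) :=
    ⟨fun h => (h.add hw).congr fun t _ => by simp, fun h => h.sub hw⟩
  have hl : ∀ s, B *ᵥ (z s - w s) + (C *ᵥ p s + B *ᵥ w s) = B *ᵥ z s + C *ᵥ p s := fun s => by
    rw [Matrix.mulVec_sub]; abel
  simp only [hcont, hl] at key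
  have hsub : (∀ t, 0 ≤ t → z t = z 0 + (∫ s in (0 : ℝ)..t, (B *ᵥ z s + C *ᵥ p s)) + w t) ↔
      ∀ t, 0 ≤ t → z t - w t = z 0 + ∫ s in (0 : ℝ)..t, (B *ᵥ z s + C *ᵥ p s) :=
    forall₂_congr fun t _ => sub_eq_iff_eq_add.symm
  rw [hsub, key]
  refine forall₂_congr fun t ht => ?_
  rw [sub_eq_iff_eq_add, memoryTerm_flow_eq hp ht]
  have hsplit : ∫ s in (0 : ℝ)..t, flow B (-s) *ᵥ (C *ᵥ p s + B *ᵥ w s)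
      = (∫ s in (0 : ℝ)..t, flow B (-s) *ᵥ (C *ᵥ p s))
        + ∫ s in (0 : ℝ)..t, flow B (-s) *ᵥ (B *ᵥ w s) := by
    simp only [Matrix.mulVec_add]
    exact intervalIntegral.integral_add (intervalIntegrable_of_continuousOn (by fun_prop) ht)
      (intervalIntegrable_of_continuousOn (by fun_prop) ht)
  have hrhs : ∀ a b : Fin m → ℝ, flow B t *ᵥ (z 0 + (a + b)) + w t
      = flow B t *ᵥ a + flow B t *ᵥ (z 0 + (flow B (-t) *ᵥ w t + b)) := by
    intro a b
    simp only [Matrix.mulVec_add, Matrix.mulVec_mulVec, flow_mul_flow_neg, Matrix.one_mulVec]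
    abel
  rw [hsplit, hrhs, flowIntegral]

/-- Elimination of the auxiliary variable turns the first-order model into the generalized
Langevin equation with kernel `e^{Bt} C` and noise `f₁ - g`. -/
theorem solvesFirstOrder_iff {Feff : (Fin m → ℝ) → (Fin m → ℝ)} (hF : Continuous Feff)
    {Γ₁₁ : Matrix (Fin m) (Fin m) ℝ} (hw : ContinuousOn w (Ici 0)) {w₁ g q p z : ℝ → Fin m → ℝ}
    (hg : ∀ t, 0 ≤ t → g t = flow B t *ᵥ (z 0 + flowIntegral B w t)) :
    SolvesFirstOrder Feff Γ₁₁ B C w₁ w q p z ↔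
      SolvesGLE Feff Γ₁₁ (fun t => flow B t * C) (fun t => w₁ t - ∫ s in (0 : ℝ)..t, g s) q p ∧
        ∀ t, 0 ≤ t → z t = memoryTerm (fun t => flow B t * C) p t + g t := by
  have hgc : ContinuousOn g (Ici 0) := by
    have h : ContinuousOn (fun t => flow B t *ᵥ (z 0 + flowIntegral B w t)) (Ici 0) :=
      (continuous_flow B).continuousOn.matrix_mulVec
        (continuousOn_const.add (continuousOn_flowIntegral hw))
    exact h.congr hg
  have hz : ContinuousOn p (Ici 0) → ((ContinuousOn z (Ici 0) ∧
        ∀ t, 0 ≤ t → z t = z 0 + (∫ s in (0 : ℝ)..t, (B *ᵥ z s + C *ᵥ p s)) + w t) ↔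
      ∀ t, 0 ≤ t → z t = memoryTerm (fun t => flow B t * C) p t + g t) := by
    intro hp
    rw [auxiliary_equation_iff hw hp]
    exact forall₂_congr fun t ht => by rw [hg t ht]
  -- once `z` is the memory term plus `g`, the two equations for `p` are the same
  have hpeq : ContinuousOn q (Ici 0) → ContinuousOn p (Ici 0) →
      (∀ t, 0 ≤ t → z t = memoryTerm (fun t => flow B t * C) p t + g t) → ∀ t, 0 ≤ t →
      p 0 + (∫ s in (0 : ℝ)..t, (Feff (q s) - Γ₁₁ *ᵥ p s - z s)) + w₁ t
        = p 0 + (∫ s in (0 : ℝ)..t, (Feff (q s) - Γ₁₁ *ᵥ p s -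
            memoryTerm (fun t => flow B t * C) p s)) + (w₁ t - ∫ s in (0 : ℝ)..t, g s) := by
    intro hq hp hz t ht
    have hmem := continuousOn_memoryTerm (B := B) (C := C) hp
    have hFq : ContinuousOn (fun s => Feff (q s)) (Ici 0) := hF.comp_continuousOn hq
    have h : ∫ s in (0 : ℝ)..t, (Feff (q s) - Γ₁₁ *ᵥ p s - z s)
        = (∫ s in (0 : ℝ)..t, (Feff (q s) - Γ₁₁ *ᵥ p s -
            memoryTerm (fun t => flow B t * C) p s)) - ∫ s in (0 : ℝ)..t, g s := by
      rw [← intervalIntegral.integral_sub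
        (intervalIntegrable_of_continuousOn (by fun_prop) ht)
        (intervalIntegrable_of_continuousOn hgc ht)]
      refine intervalIntegral.integral_congr fun s hs => ?_
      rw [uIcc_of_le ht] at hs
      simp only [hz s hs.1]
      abel
    rw [h]
    abel
  constructor
  · rintro ⟨hq, hp, hzc, eq_q, eq_p, eq_z⟩
    have hz' := (hz hp).1 ⟨hzc, eq_z⟩
    exact ⟨⟨hq, hp, eq_q, fun t ht => (eq_p t ht).trans (hpeq hq hp hz' t ht)⟩, hz'⟩
  · rintro ⟨⟨hq, hp, eq_q, eq_p⟩, hz'⟩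
    obtain ⟨hzc, eq_z⟩ := (hz hp).2 hz'
    exact ⟨hq, hp, hzc, eq_q, fun t ht => (eq_p t ht).trans (hpeq hq hp hz' t ht).symm, eq_z⟩

end Pathwise

/-! ### Symmetry of the moments -/

section Moments

variable {d m k : ℕ} {A Γ : Matrix (Fin d) (Fin d) ℝ} {Φ : Matrix (Fin d) (Fin m) ℝ}
  {Ψ : Matrix (Fin d) (Fin k) ℝ}

/-- The memory kernel is symmetric.  With `J = diag(A₂₂⁻¹, -I)` the product `G J` is symmetric, so
`e^{-tG} J = J e^{-tGᵀ}`. -/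
lemma memoryKernel_transpose (hA : A.PosDef) (hΓ : Γ.PosSemidef) (hΨ : Ψᵀ * Ψ = 1) (t : ℝ) :
    (memoryKernel A Γ Φ Ψ t)ᵀ = memoryKernel A Γ Φ Ψ t := by
  have hAt : Aᵀ = A := by simpa [Matrix.IsHermitian] using hA.1
  have hΓt : Γᵀ = Γ := by simpa [Matrix.IsHermitian] using hΓ.1
  have hinj : Function.Injective Ψ.mulVec := fun x y hxy => by
    simpa [Matrix.mulVec_mulVec, hΨ] using congrArg (Ψᵀ *ᵥ ·) hxy
  have hdet : IsUnit (Ψᵀ * A * Ψ).det := by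
    have h := hA.conjTranspose_mul_mul_same hinj
    rw [Matrix.conjTranspose_eq_transpose_of_trivial] at h
    exact h.det_pos.ne'.isUnit
  have h22 : (Ψᵀ * A * Ψ)ᵀ = Ψᵀ * A * Ψ := by
    simp [Matrix.transpose_mul, hAt, Matrix.mul_assoc]
  have hΓ22 : (Ψᵀ * Γ * Ψ)ᵀ = Ψᵀ * Γ * Ψ := by
    simp [Matrix.transpose_mul, hΓt, Matrix.mul_assoc]
  set J : Matrix (Fin k ⊕ Fin k) (Fin k ⊕ Fin k) ℝ :=
    Matrix.fromBlocks (Ψᵀ * A * Ψ)⁻¹ 0 0 (-1) with hJ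
  have hJt : Jᵀ = J := by
    rw [hJ, Matrix.fromBlocks_transpose, Matrix.transpose_nonsing_inv, h22]
    simp
  have hG : SemiconjBy J (matG A Γ Ψ)ᵀ (matG A Γ Ψ) := by
    rw [SemiconjBy, matG, Matrix.fromBlocks_transpose, h22, hΓ22, hJ, Matrix.fromBlocks_multiply,
      Matrix.fromBlocks_multiply, Matrix.mul_nonsing_inv _ hdet, Matrix.nonsing_inv_mul _ hdet]
    simp
  have hexp := (semiconjBy_flow hG (-t)).eq
  rw [memoryKernel, ← hJ, ← neg_smul]
  simp only [Matrix.transpose_mul, Matrix.transpose_fromCols, Matrix.transpose_fromRows, hJt,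
    Matrix.transpose_transpose, hAt, hΓt, ← Matrix.exp_transpose, Matrix.transpose_smul]
  rw [← Matrix.mul_assoc J, hexp]
  simp only [Matrix.mul_assoc]

lemma momentZero_transpose (hA : A.PosDef) (hΓ : Γ.PosSemidef) (hΨ : Ψᵀ * Ψ = 1) :
    (momentZero A Γ Φ Ψ)ᵀ = momentZero A Γ Φ Ψ :=
  memoryKernel_transpose hA hΓ hΨ 0

lemma momentInfty_transpose (hA : A.PosDef) (hΓ : Γ.PosSemidef) (hΨ : Ψᵀ * Ψ = 1) :
    (momentInfty A Γ Φ Ψ)ᵀ = momentInfty A Γ Φ Ψ := by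
  ext i j
  simp only [momentInfty, Matrix.transpose_apply, Matrix.of_apply]
  congr 1
  funext t
  exact congrFun (congrFun (memoryKernel_transpose hA hΓ hΨ t) i) j

/-- The coefficients `C = M₀` and `B = -M₀ M_∞⁻¹` satisfy `B C = C Bᵀ`, since `M₀` and `M_∞` are
symmetric. -/
lemma mul_eq_mul_transpose_of_moments (hA : A.PosDef) (hΓ : Γ.PosSemidef) (hΨ : Ψᵀ * Ψ = 1)
    {B C : Matrix (Fin m) (Fin m) ℝ} (hC : C = momentZero A Γ Φ Ψ)
    (hB : B = -(momentZero A Γ Φ Ψ * (momentInfty A Γ Φ Ψ)⁻¹)) : B * C = C * Bᵀ := by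
  rw [hB, hC, Matrix.transpose_neg, Matrix.transpose_mul, Matrix.transpose_nonsing_inv,
    momentZero_transpose hA hΓ hΨ, momentInfty_transpose hA hΓ hΨ]
  simp [Matrix.mul_assoc]

end Moments

/-! ### Covariance of the colored noise -/

section Covariance

variable {m : ℕ} {Ω : Type*} [MeasurableSpace Ω] {μ : Measure Ω}

/-- Integration by parts against `min r s`, which has derivative `1` in `s` before `r` and `0`
after. -/
lemma mul_sub_integral_min {f f' : ℝ → ℝ} (hf : ∀ s, HasDerivAt f (f' s) s)
    (hf' : Continuous f') {r t : ℝ} (hr : 0 ≤ r) (hrt : r ≤ t) :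
    r * f t - ∫ s in (0 : ℝ)..t, min r s * f' s = ∫ s in (0 : ℝ)..r, f s := by
  have hc : Continuous fun s => min r s * f' s := by fun_prop
  rw [← intervalIntegral.integral_add_adjacent_intervals (b := r) (hc.intervalIntegrable _ _)
    (hc.intervalIntegrable _ _)]
  have h1 : ∫ s in (0 : ℝ)..r, min r s * f' s = r * f r - ∫ s in (0 : ℝ)..r, f s := by
    have h := intervalIntegral.integral_mul_deriv_eq_deriv_mul (a := 0) (b := r)
      (fun s _ => hasDerivAt_id s) (fun s _ => hf s) (by simp) (hf'.intervalIntegrable _ _)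
    simp only [id, one_mul, zero_mul, sub_zero] at h
    rw [← h]
    refine intervalIntegral.integral_congr fun s hs => ?_
    rw [uIcc_of_le hr] at hs
    simp only [min_eq_right hs.2]
  have h2 : ∫ s in r..t, min r s * f' s = r * (f t - f r) := by
    rw [← intervalIntegral.integral_eq_sub_of_hasDerivAt (fun s _ => hf s)
      (hf'.intervalIntegrable _ _), ← intervalIntegral.integral_const_mul]
    refine intervalIntegral.integral_congr fun s hs => ?_
    rw [uIcc_of_le hrt] at hs
    simp only [min_eq_left hs.1]
  rw [h1, h2]
  ring

/-- The data driving the colored noise, in a common Gaussian space `V`: an initial value with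
covariance `c C` and an independent Wiener process `W` with covariance matrix `-2 c C Bᵀ`. -/
structure IsDrivenNoise (V : Submodule ℝ (Ω → ℝ)) (B C : Matrix (Fin m) (Fin m) ℝ) (c : ℝ)
    (z₀ : Ω → Fin m → ℝ) (W : ℝ → Ω → Fin m → ℝ) (μ : Measure Ω) : Prop where
  gaussian : IsGaussianSpace V μ
  mul_eq : B * C = C * Bᵀ
  symm : Cᵀ = C
  init_mem : ∀ i, (fun ω => z₀ ω i) ∈ V
  mem : ∀ t, 0 ≤ t → ∀ i, (fun ω => W t ω i) ∈ V
  cov_init : ∀ i j, cov[fun ω => z₀ ω i, fun ω => z₀ ω j; μ] = (c • C) i j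
  cov_init_wiener : ∀ t, 0 ≤ t → ∀ i j, cov[fun ω => z₀ ω i, fun ω => W t ω j; μ] = 0
  cov_wiener : ∀ s t, 0 ≤ s → 0 ≤ t → ∀ i j,
    cov[fun ω => W s ω i, fun ω => W t ω j; μ] = min s t * (-(2 * c) • (C * Bᵀ)) i j
  start : ∀ᵐ ω ∂μ, W 0 ω = 0
  cont : ∀ᵐ ω ∂μ, ContinuousOn (fun t => W t ω) (Ici 0)

lemma twoTime_add_right (K : ℝ → Matrix (Fin m) (Fin m) ℝ) (u v r : ℝ) :
    twoTime K (u + r) (v + r) = twoTime K u v := by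
  simp [twoTime]

lemma flow_mul_of_mul_eq {B C : Matrix (Fin m) (Fin m) ℝ} (h : B * C = C * Bᵀ) (t : ℝ) :
    flow B t * C = C * (flow B t)ᵀ := by
  have h' : SemiconjBy C Bᵀ B := h.symm
  rw [flow, ← Matrix.exp_transpose, Matrix.transpose_smul]
  exact (semiconjBy_flow h' t).eq.symm

namespace IsDrivenNoise

variable {V : Submodule ℝ (Ω → ℝ)} {B C : Matrix (Fin m) (Fin m) ℝ} {c : ℝ}
  {z₀ : Ω → Fin m → ℝ} {W : ℝ → Ω → Fin m → ℝ}

lemma mulVec_mem (h : IsDrivenNoise V B C c z₀ W μ) (A : Matrix (Fin m) (Fin m) ℝ) {t : ℝ}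
    (ht : 0 ≤ t) (i : Fin m) : (fun ω => (A *ᵥ W t ω) i) ∈ V :=
  sum_mul_mem (A i) fun k => h.mem t ht k

lemma ae_integral_apply (h : IsDrivenNoise V B C c z₀ W μ) {t : ℝ} (ht : 0 ≤ t) (i : Fin m) :
    ∀ᵐ ω ∂μ, (∫ s in (0 : ℝ)..t, flow B (-s) *ᵥ (B *ᵥ W s ω)) i
      = ∫ s in (0 : ℝ)..t, ((flow B (-s) * B) *ᵥ W s ω) i := by
  filter_upwards [h.cont] with ω hω
  rw [intervalIntegral_apply (intervalIntegrable_of_continuousOn (by fun_prop) ht)]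
  simp only [Matrix.mulVec_mulVec]

lemma ae_continuousOn (h : IsDrivenNoise V B C c z₀ W μ) (i : Fin m) :
    ∀ᵐ ω ∂μ, ContinuousOn (fun s => ((flow B (-s) * B) *ᵥ W s ω) i) (Ici 0) := by
  filter_upwards [h.cont] with ω hω
  have : ContinuousOn (fun s => (flow B (-s) * B) *ᵥ W s ω) (Ici 0) := by
    simp only [← Matrix.mulVec_mulVec]
    fun_prop
  fun_prop

lemma wiener_symm (h : IsDrivenNoise V B C c z₀ W μ) : (C * Bᵀ)ᵀ = C * Bᵀ := by
  rw [Matrix.transpose_mul, Matrix.transpose_transpose, h.symm, h.mul_eq]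

lemma ae_coloredNoise_eq (h : IsDrivenNoise V B C c z₀ W μ) :
    ∀ᵐ ω ∂μ, ∀ t, 0 ≤ t → coloredNoise B z₀ W t ω
      = flow B t *ᵥ (z₀ ω + flowIntegral B (fun s => W s ω) t) := by
  filter_upwards [h.cont, h.start] with ω h1 h2 t ht using coloredNoise_eq h1 h2 ht

lemma integral_mem (h : IsDrivenNoise V B C c z₀ W μ) {t : ℝ} (ht : 0 ≤ t) (i : Fin m) :
    (fun ω => (∫ s in (0 : ℝ)..t, flow B (-s) *ᵥ (B *ᵥ W s ω)) i) ∈ aeLimits V μ :=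
  integral_mem_aeLimits ht (fun _ hs => h.mulVec_mem _ hs i) (h.ae_continuousOn i)
    (h.ae_integral_apply ht i)

lemma ae_continuousOn_coloredNoise (h : IsDrivenNoise V B C c z₀ W μ) :
    ∀ᵐ ω ∂μ, ContinuousOn (fun t => coloredNoise B z₀ W t ω) (Ici 0) := by
  filter_upwards [h.cont, h.ae_coloredNoise_eq] with ω h1 h2
  have h3 : ContinuousOn (fun t => flow B t *ᵥ (z₀ ω + flowIntegral B (fun s => W s ω) t))
      (Ici 0) :=
    (continuous_flow B).continuousOn.matrix_mulVec
      (continuousOn_const.add (continuousOn_flowIntegral h1))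
  exact h3.congr h2

lemma flowIntegral_mem (h : IsDrivenNoise V B C c z₀ W μ) {t : ℝ} (ht : 0 ≤ t) (i : Fin m) :
    (fun ω => flowIntegral B (fun s => W s ω) t i) ∈ aeLimits V μ :=
  (aeLimits V μ).add_mem (le_aeLimits (h.mulVec_mem (flow B (-t)) ht i)) (h.integral_mem ht i)

lemma init_add_flowIntegral_mem (h : IsDrivenNoise V B C c z₀ W μ) {t : ℝ} (ht : 0 ≤ t)
    (i : Fin m) :
    (fun ω => z₀ ω i + flowIntegral B (fun s => W s ω) t i) ∈ aeLimits V μ :=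
  (aeLimits V μ).add_mem (le_aeLimits (h.init_mem i)) (h.flowIntegral_mem ht i)

lemma coloredNoise_mem (h : IsDrivenNoise V B C c z₀ W μ) {t : ℝ} (ht : 0 ≤ t) (i : Fin m) :
    (fun ω => coloredNoise B z₀ W t ω i) ∈ aeLimits V μ := by
  refine aeLimits_congr (sum_mul_mem (flow B t i) fun k => h.init_add_flowIntegral_mem ht k) ?_
  filter_upwards [h.ae_coloredNoise_eq] with ω hω
  rw [hω t ht]
  rfl

variable [IsProbabilityMeasure μ]

lemma covariance_mulVec (h : IsDrivenNoise V B C c z₀ W μ) (A : Matrix (Fin m) (Fin m) ℝ)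
    {X : Ω → ℝ} (hX : X ∈ aeLimits V μ) {t : ℝ} (ht : 0 ≤ t) (i : Fin m) :
    cov[X, fun ω => (A *ᵥ W t ω) i; μ] = ∑ k, A i k * cov[X, fun ω => W t ω k; μ] :=
  covariance_sum_mul_right (A i) (h.gaussian.aeLimits X hX) fun k => h.gaussian _ (h.mem t ht k)

/-- Covariances with `M(t) = ∫₀ᵗ e^{-sB} dW(s)` in terms of covariances with `W`. -/
lemma covariance_flowIntegral (h : IsDrivenNoise V B C c z₀ W μ) {X : Ω → ℝ}
    (hX : X ∈ aeLimits V μ) {t : ℝ} (ht : 0 ≤ t) (i : Fin m) :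
    cov[X, fun ω => flowIntegral B (fun s => W s ω) t i; μ]
      = (∑ k, flow B (-t) i k * cov[X, fun ω => W t ω k; μ]) +
        ∫ s in (0 : ℝ)..t, ∑ k, (flow B (-s) * B) i k * cov[X, fun ω => W s ω k; μ] := by
  have hV' := h.gaussian.aeLimits
  have hX2 := (hV' X hX).memLp_two
  have hZ := h.integral_mem ht i
  -- the variance of the integrand is a continuous function of time, hence bounded
  obtain ⟨M, hM⟩ : ∃ M, ∀ s, 0 ≤ s → s ≤ t → cov[fun ω => ((flow B (-s) * B) *ᵥ W s ω) i,
      fun ω => ((flow B (-s) * B) *ᵥ W s ω) i; μ] ≤ M := by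
    let v : ℝ → ℝ := fun s => ∑ k, (flow B (-s) * B) i k * ∑ l, (flow B (-s) * B) i l *
      (min s s * (-(2 * c) • (C * Bᵀ)) k l)
    have hent : ∀ k l, Continuous fun s => (flow B (-s) * B) k l := fun k l => by
      have : Continuous fun s => flow B (-s) * B :=
        ((continuous_flow B).comp continuous_neg).matrix_mul continuous_const
      exact this.matrix_elem k l
    have hv : Continuous v := by fun_prop
    obtain ⟨M, hM⟩ := (isCompact_Icc (a := (0 : ℝ)) (b := t)).exists_bound_of_continuousOn
      hv.continuousOn
    refine ⟨M, fun s hs0 hst => ?_⟩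
    refine Eq.trans_le ?_ ((le_abs_self _).trans (hM s ⟨hs0, hst⟩))
    rw [h.covariance_mulVec _ (le_aeLimits (h.mulVec_mem _ hs0 i)) hs0]
    refine Finset.sum_congr rfl fun k _ => ?_
    rw [covariance_comm, h.covariance_mulVec _ (le_aeLimits (h.mem s hs0 k)) hs0]
    simp only [h.cov_wiener s s hs0 hs0]
  have hint := hV'.covariance_integral ht hX (fun s hs => le_aeLimits (h.mulVec_mem _ hs i))
    (h.ae_continuousOn i) hM hZ (h.ae_integral_apply ht i)
  have hadd := covariance_add_right hX2
    (hV' _ (le_aeLimits (h.mulVec_mem (flow B (-t)) ht i))).memLp_two (hV' _ hZ).memLp_two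
  refine hadd.trans ?_
  rw [h.covariance_mulVec _ hX ht, hint]
  congr 1
  refine intervalIntegral.integral_congr fun s hs => ?_
  rw [uIcc_of_le ht] at hs
  exact h.covariance_mulVec _ hX hs.1 i

lemma covariance_flowIntegral_eq_zero (h : IsDrivenNoise V B C c z₀ W μ) {X : Ω → ℝ}
    (hX : X ∈ aeLimits V μ) (hXW : ∀ t, 0 ≤ t → ∀ k, cov[X, fun ω => W t ω k; μ] = 0) {t : ℝ}
    (ht : 0 ≤ t) (i : Fin m) :
    cov[X, fun ω => flowIntegral B (fun s => W s ω) t i; μ] = 0 := by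
  rw [h.covariance_flowIntegral hX ht]
  have h1 : ∫ s in (0 : ℝ)..t, ∑ k, (flow B (-s) * B) i k * cov[X, fun ω => W s ω k; μ]
      = ∫ s in (0 : ℝ)..t, (0 : ℝ) := by
    refine intervalIntegral.integral_congr fun s hs => ?_
    rw [uIcc_of_le ht] at hs
    simp [hXW s hs.1]
  rw [h1]
  simp [hXW t ht]

lemma covariance_init_flowIntegral (h : IsDrivenNoise V B C c z₀ W μ) {t : ℝ} (ht : 0 ≤ t)
    (i j : Fin m) :
    cov[fun ω => z₀ ω i, fun ω => flowIntegral B (fun s => W s ω) t j; μ] = 0 :=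
  h.covariance_flowIntegral_eq_zero (le_aeLimits (h.init_mem i))
    (fun _ hs k => h.cov_init_wiener _ hs i k) ht j

/-- `⟨M(t) W(r)ᵀ⟩ = ∫₀ʳ e^{-sB} Σ ds` for `r ≤ t`, where `M(t) = ∫₀ᵗ e^{-sB} dW(s)`. -/
lemma covariance_flowIntegral_wiener (h : IsDrivenNoise V B C c z₀ W μ) {r t : ℝ} (hr : 0 ≤ r)
    (hrt : r ≤ t) (i j : Fin m) :
    cov[fun ω => flowIntegral B (fun s => W s ω) t i, fun ω => W r ω j; μ]
      = ∫ s in (0 : ℝ)..r, (flow B (-s) * (-(2 * c) • (C * Bᵀ))) i j := by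
  set S := -(2 * c) • (C * Bᵀ) with hS
  have hSt : ∀ a b, S a b = S b a := fun a b => by
    have : Sᵀ = S := by rw [hS, Matrix.transpose_smul, h.wiener_symm]
    exact (congrFun (congrFun this b) a)
  have hd : ∀ s, HasDerivAt (fun s => (flow B (-s) * S) i j) (-((flow B (-s) * B) * S) i j) s := by
    intro s
    have h1 := HasDerivAt.fun_sum (u := Finset.univ) fun k _ =>
      (hasDerivAt_flow_neg_apply B s i k).mul_const (S k j)
    refine h1.congr_deriv ?_
    rw [← (commute_flow B (-s)).eq, Matrix.mul_apply (M := B * flow B (-s)),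
      ← Finset.sum_neg_distrib]
    exact Finset.sum_congr rfl fun k _ => neg_mul _ _
  have hcont : Continuous fun s => -((flow B (-s) * B) * S) i j := by
    have : Continuous fun s => -((flow B (-s) * B) * S) :=
      ((((continuous_flow B).comp continuous_neg).matrix_mul continuous_const).matrix_mul
        continuous_const).neg
    exact this.matrix_elem i j
  rw [← mul_sub_integral_min hd hcont hr hrt, covariance_comm,
    h.covariance_flowIntegral (le_aeLimits (h.mem r hr j)) (hr.trans hrt), sub_eq_add_neg,
    ← intervalIntegral.integral_neg]
  congr 1
  · simp only [h.cov_wiener r t hr (hr.trans hrt), min_eq_left hrt, Matrix.mul_apply,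
      Finset.mul_sum]
    refine Finset.sum_congr rfl fun k _ => ?_
    rw [← hS, hSt j k]
    ring
  · refine intervalIntegral.integral_congr fun s hs => ?_
    rw [uIcc_of_le (hr.trans hrt)] at hs
    simp only [h.cov_wiener r s hr hs.1, mul_neg, neg_neg]
    rw [Matrix.mul_apply (M := flow B (-s) * B), Finset.mul_sum]
    refine Finset.sum_congr rfl fun k _ => ?_
    rw [← hS, hSt j k]
    ring

/-- `⟨M(t) M(s)ᵀ⟩ = c (e^{-2sB} C - C)` for `s ≤ t`, where `M(t) = ∫₀ᵗ e^{-uB} dW(u)`.  By the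
Lyapunov equation `Σ = -2 c B C` both sides are `∫₀ˢ e^{-uB} Σ e^{-uBᵀ} du`. -/
lemma covariance_flowIntegral_flowIntegral (h : IsDrivenNoise V B C c z₀ W μ) {s t : ℝ}
    (hs : 0 ≤ s) (hst : s ≤ t) (i j : Fin m) :
    cov[fun ω => flowIntegral B (fun s => W s ω) t i,
      fun ω => flowIntegral B (fun s => W s ω) s j; μ]
      = c * ((flow B (-(2 * s)) * C) i j - C i j) := by
  set S := -(2 * c) • (C * Bᵀ) with hS
  let P : Fin m → ℝ → ℝ := fun k r => ∫ s in (0 : ℝ)..r, (flow B (-s) * S) i k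
  have hent : ∀ (A : Matrix (Fin m) (Fin m) ℝ) (k l : Fin m),
      Continuous fun s => (flow B (-s) * A) k l := fun A k l => by
    have : Continuous fun s => flow B (-s) * A :=
      ((continuous_flow B).comp continuous_neg).matrix_mul continuous_const
    exact this.matrix_elem k l
  have hP : ∀ k r, HasDerivAt (P k) ((flow B (-r) * S) i k) r := fun k r =>
    ((hent S i k).integral_hasStrictDerivAt 0 r).hasDerivAt
  have hPc : ∀ k, Continuous (P k) := fun k =>
    continuous_iff_continuousAt.2 fun r => (hP k r).continuousAt
  let Q : ℝ → ℝ := fun u => c * ((flow B (-(2 * u)) * C) i j - C i j)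
  have hQ : ∀ u, HasDerivAt Q (∑ k, flow B (-u) j k * (flow B (-u) * S) i k) u := by
    intro u
    have hsc : HasDerivAt (fun u : ℝ => -(2 * u)) (-2) u :=
      ((hasDerivAt_id u).const_mul 2).neg.congr_deriv (by simp)
    have h1 := HasDerivAt.fun_sum (u := Finset.univ) fun k _ =>
      ((hasDerivAt_flow_apply B (-(2 * u)) i k).comp u hsc).mul_const (C k j)
    refine ((h1.sub_const (C i j)).const_mul c).congr_deriv ?_
    have hl : ∑ k, flow B (-u) j k * (flow B (-u) * S) i k
        = (flow B (-u) * S * (flow B (-u))ᵀ) i j := by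
      rw [Matrix.mul_apply (M := flow B (-u) * S)]
      exact Finset.sum_congr rfl fun k _ => mul_comm _ _
    have hr : c * ∑ k, (B * flow B (-(2 * u))) i k * -2 * C k j
        = (-(2 * c) • (B * flow B (-(2 * u)) * C)) i j := by
      rw [Matrix.smul_apply, Matrix.mul_apply (M := B * flow B (-(2 * u))), smul_eq_mul,
        Finset.mul_sum, Finset.mul_sum]
      exact Finset.sum_congr rfl fun k _ => by ring
    rw [hl, hr, hS, ← h.mul_eq, Matrix.mul_smul, Matrix.smul_mul]
    refine congrArg (fun A : Matrix (Fin m) (Fin m) ℝ => (-(2 * c) • A) i j) ?_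
    rw [show -(2 * u) = -u + -u by ring, flow_add, ← Matrix.mul_assoc (flow B (-u)) B C,
      ← (commute_flow B (-u)).eq]
    simp only [Matrix.mul_assoc]
    rw [← flow_mul_of_mul_eq h.mul_eq]
  have hG : ∀ u, HasDerivAt (fun u => (∑ k, flow B (-u) j k * P k u) - Q u)
      (-∑ k, (flow B (-u) * B) j k * P k u) u := by
    intro u
    have h1 := HasDerivAt.fun_sum (u := Finset.univ) fun k _ =>
      (hasDerivAt_flow_neg_apply B u j k).mul (hP k u)
    refine (h1.sub (hQ u)).congr_deriv ?_
    rw [Finset.sum_add_distrib, add_sub_cancel_right, (commute_flow B (-u)).eq,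
      ← Finset.sum_neg_distrib]
    exact Finset.sum_congr rfl fun k _ => by ring
  have hint := intervalIntegral.integral_eq_sub_of_hasDerivAt (a := 0) (b := s)
    (fun u _ => hG u) ((by fun_prop : Continuous _).intervalIntegrable _ _)
  rw [intervalIntegral.integral_neg] at hint
  have h0 : (∑ k, flow B (-0) j k * P k 0) - Q 0 = 0 := by simp [P, Q, flow_zero]
  rw [h0, sub_zero] at hint
  rw [h.covariance_flowIntegral (h.flowIntegral_mem (hs.trans hst) i) hs]
  have hsum : ∑ k, flow B (-s) j k *
      cov[fun ω => flowIntegral B (fun s => W s ω) t i, fun ω => W s ω k; μ]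
      = ∑ k, flow B (-s) j k * P k s :=
    Finset.sum_congr rfl fun k _ => by rw [h.covariance_flowIntegral_wiener hs hst]
  have hintc : ∫ u in (0 : ℝ)..s, ∑ k, (flow B (-u) * B) j k *
      cov[fun ω => flowIntegral B (fun s => W s ω) t i, fun ω => W u ω k; μ]
      = ∫ u in (0 : ℝ)..s, ∑ k, (flow B (-u) * B) j k * P k u := by
    refine intervalIntegral.integral_congr fun u hu => ?_
    rw [uIcc_of_le hs] at hu
    exact Finset.sum_congr rfl fun k _ => by
      rw [h.covariance_flowIntegral_wiener hu.1 (hu.2.trans hst)]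
  rw [hsum, hintc]
  change _ = Q s
  linarith

/-- `⟨g(t) g(s)ᵀ⟩ = c e^{(t-s)B} C` for `s ≤ t`. -/
lemma covariance_coloredNoise (h : IsDrivenNoise V B C c z₀ W μ) {s t : ℝ} (hs : 0 ≤ s)
    (hst : s ≤ t) (i j : Fin m) :
    cov[fun ω => coloredNoise B z₀ W t ω i, fun ω => coloredNoise B z₀ W s ω j; μ]
      = (c • (flow B (t - s) * C)) i j := by
  have ht := hs.trans hst
  have hV' := h.gaussian.aeLimits
  have hn : ∀ {r : ℝ}, 0 ≤ r → ∀ a, IsCenteredNormal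
      (fun ω => z₀ ω a + flowIntegral B (fun s => W s ω) r a) μ := fun hr a =>
    hV' _ (h.init_add_flowIntegral_mem hr a)
  have hae : ∀ {r : ℝ}, 0 ≤ r → ∀ a, (fun ω => coloredNoise B z₀ W r ω a) =ᵐ[μ]
      fun ω => ∑ b, flow B r a b * (z₀ ω b + flowIntegral B (fun s => W s ω) r b) := by
    intro r hr a
    filter_upwards [h.ae_coloredNoise_eq] with ω hω
    rw [hω r hr]
    rfl
  have hz2 : ∀ a, MemLp (fun ω => z₀ ω a) 2 μ := fun a =>
    (h.gaussian _ (h.init_mem a)).memLp_two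
  have hm2 : ∀ {r : ℝ}, 0 ≤ r → ∀ a,
      MemLp (fun ω => flowIntegral B (fun s => W s ω) r a) 2 μ := fun hr a =>
    (hV' _ (h.flowIntegral_mem hr a)).memLp_two
  have hbase : ∀ a b, cov[fun ω => z₀ ω a + flowIntegral B (fun s => W s ω) t a,
      fun ω => z₀ ω b + flowIntegral B (fun s => W s ω) s b; μ]
      = c * (flow B (-(2 * s)) * C) a b := by
    intro a b
    have e1 := covariance_add_left (Z := fun ω => z₀ ω b + flowIntegral B (fun s => W s ω) s b)
      (hz2 a) (hm2 ht a) (hn hs b).memLp_two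
    have e2 := covariance_add_right (hz2 a) (hz2 b) (hm2 hs b)
    have e3 := covariance_add_right (hm2 ht a) (hz2 b) (hm2 hs b)
    refine e1.trans ((congrArg₂ (· + ·) e2 e3).trans ?_)
    rw [h.cov_init, h.covariance_init_flowIntegral hs,
      covariance_comm (fun ω => flowIntegral B (fun s => W s ω) t a),
      h.covariance_init_flowIntegral ht, h.covariance_flowIntegral_flowIntegral hs hst,
      Matrix.smul_apply, smul_eq_mul]
    ring
  rw [covariance_congr_ae (hae ht i) (hae hs j), covariance_comm,
    covariance_sum_mul_right _ (hV' _ (sum_mul_mem _ fun k => h.init_add_flowIntegral_mem hs k))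
      (hn ht)]
  have hinner : ∀ a, cov[fun ω => ∑ b,
      flow B s j b * (z₀ ω b + flowIntegral B (fun s => W s ω) s b),
      fun ω => z₀ ω a + flowIntegral B (fun s => W s ω) t a; μ]
      = (c • (flow B (-(2 * s)) * C * (flow B s)ᵀ)) a j := by
    intro a
    rw [covariance_comm, covariance_sum_mul_right _ (hn ht a) (hn hs), Matrix.smul_apply,
      Matrix.mul_apply (M := flow B (-(2 * s)) * C), smul_eq_mul, Finset.mul_sum]
    refine Finset.sum_congr rfl fun b _ => ?_
    rw [hbase, Matrix.transpose_apply]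
    ring
  simp only [hinner]
  rw [← Matrix.mul_apply, Matrix.mul_smul, Matrix.mul_assoc, ← flow_mul_of_mul_eq h.mul_eq,
    ← Matrix.mul_assoc, ← Matrix.mul_assoc, ← flow_add, ← flow_add,
    show t + -(2 * s) + s = t - s by ring]

lemma covariance_coloredNoise_eq_twoTime (h : IsDrivenNoise V B C c z₀ W μ) {s t : ℝ}
    (hs : 0 ≤ s) (ht : 0 ≤ t) (i j : Fin m) :
    cov[fun ω => coloredNoise B z₀ W s ω i, fun ω => coloredNoise B z₀ W t ω j; μ]
      = twoTime (fun t => c • (flow B t * C)) s t i j := by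
  unfold twoTime
  split_ifs with hts
  · exact h.covariance_coloredNoise ht hts i j
  · rw [covariance_comm, h.covariance_coloredNoise hs (not_le.1 hts).le]
    rfl

/-- The colored noise is stationary: it is Gaussian and its covariance depends on the lag only. -/
lemma isStationary_coloredNoise (h : IsDrivenNoise V B C c z₀ W μ) :
    IsStationary (coloredNoise B z₀ W) μ := by
  intro r I
  refine h.gaussian.aeLimits.map_eq_map
    (X := fun t : I => coloredNoise B z₀ W ((t : ℝ≥0) + r : ℝ≥0))
    (Y := fun t : I => coloredNoise B z₀ W (t : ℝ≥0))
    (fun t i => h.coloredNoise_mem (by positivity) i)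
    (fun t i => h.coloredNoise_mem (by positivity) i) fun s t i j => ?_
  rw [h.covariance_coloredNoise_eq_twoTime (by positivity) (by positivity),
    h.covariance_coloredNoise_eq_twoTime (by positivity) (by positivity)]
  rw [NNReal.coe_add, NNReal.coe_add, twoTime_add_right]

end IsDrivenNoise

end Covariance

/-! ### The total noise -/

section TotalNoise

variable {m : ℕ} {Ω : Type*} [MeasurableSpace Ω] {μ : Measure Ω}
  {V : Submodule ℝ (Ω → ℝ)} {B C : Matrix (Fin m) (Fin m) ℝ} {c : ℝ} {z₀ : Ω → Fin m → ℝ}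
  {W W₁ : ℝ → Ω → Fin m → ℝ}

namespace IsDrivenNoise

lemma ae_continuousOn_coloredNoise_apply (h : IsDrivenNoise V B C c z₀ W μ) (i : Fin m) :
    ∀ᵐ ω ∂μ, ContinuousOn (fun t => coloredNoise B z₀ W t ω i) (Ici 0) := by
  filter_upwards [h.ae_continuousOn_coloredNoise] with ω hω
  fun_prop

lemma ae_integral_coloredNoise_apply (h : IsDrivenNoise V B C c z₀ W μ) {t : ℝ} (ht : 0 ≤ t)
    (i : Fin m) :
    ∀ᵐ ω ∂μ, (∫ s in (0 : ℝ)..t, coloredNoise B z₀ W s ω) i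
      = ∫ s in (0 : ℝ)..t, coloredNoise B z₀ W s ω i := by
  filter_upwards [h.ae_continuousOn_coloredNoise] with ω hω
  exact intervalIntegral_apply (intervalIntegrable_of_continuousOn hω ht) i

lemma integral_coloredNoise_mem (h : IsDrivenNoise V B C c z₀ W μ) {t : ℝ} (ht : 0 ≤ t)
    (i : Fin m) :
    (fun ω => (∫ s in (0 : ℝ)..t, coloredNoise B z₀ W s ω) i) ∈ aeLimits (aeLimits V μ) μ :=
  integral_mem_aeLimits ht (fun _ hs => h.coloredNoise_mem hs i)
    (h.ae_continuousOn_coloredNoise_apply i) (h.ae_integral_coloredNoise_apply ht i)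

lemma totalNoise_mem (h : IsDrivenNoise V B C c z₀ W μ)
    (hW₁ : ∀ t, 0 ≤ t → ∀ i, (fun ω => W₁ t ω i) ∈ V) {t : ℝ} (ht : 0 ≤ t) (i : Fin m) :
    (fun ω => totalNoise W₁ (coloredNoise B z₀ W) t ω i) ∈ aeLimits (aeLimits V μ) μ :=
  (aeLimits (aeLimits V μ) μ).sub_mem (le_aeLimits (le_aeLimits (hW₁ t ht i)))
    (h.integral_coloredNoise_mem ht i)

variable [IsProbabilityMeasure μ]

/-- The colored noise is uncorrelated with every variable of `V` that is uncorrelated with the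
driving data. -/
lemma covariance_coloredNoise_eq_zero (h : IsDrivenNoise V B C c z₀ W μ) {X : Ω → ℝ}
    (hX : X ∈ V) (hXz : ∀ k, cov[X, fun ω => z₀ ω k; μ] = 0)
    (hXW : ∀ t, 0 ≤ t → ∀ k, cov[X, fun ω => W t ω k; μ] = 0) {t : ℝ} (ht : 0 ≤ t) (i : Fin m) :
    cov[X, fun ω => coloredNoise B z₀ W t ω i; μ] = 0 := by
  have hV' := h.gaussian.aeLimits
  have hX' : X ∈ aeLimits V μ := le_aeLimits hX
  have hae : (fun ω => coloredNoise B z₀ W t ω i) =ᵐ[μ]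
      fun ω => ∑ b, flow B t i b * (z₀ ω b + flowIntegral B (fun s => W s ω) t b) := by
    filter_upwards [h.ae_coloredNoise_eq] with ω hω
    rw [hω t ht]
    rfl
  rw [covariance_congr_ae .rfl hae, covariance_sum_mul_right _ (hV' _ hX')
    fun k => hV' _ (h.init_add_flowIntegral_mem ht k)]
  refine Finset.sum_eq_zero fun k _ => ?_
  have hadd := covariance_add_right (hV' _ hX').memLp_two
    (h.gaussian _ (h.init_mem k)).memLp_two (hV' _ (h.flowIntegral_mem ht k)).memLp_two
  refine mul_eq_zero_of_right _ (hadd.trans ?_)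
  rw [hXz, h.covariance_flowIntegral_eq_zero hX' hXW ht, add_zero]

lemma covariance_integral_coloredNoise (h : IsDrivenNoise V B C c z₀ W μ) {X : Ω → ℝ}
    (hX : X ∈ aeLimits (aeLimits V μ) μ) {t : ℝ} (ht : 0 ≤ t) (i : Fin m) :
    cov[X, fun ω => (∫ s in (0 : ℝ)..t, coloredNoise B z₀ W s ω) i; μ]
      = ∫ s in (0 : ℝ)..t, cov[X, fun ω => coloredNoise B z₀ W s ω i; μ] := by
  refine h.gaussian.aeLimits.aeLimits.covariance_integral (M := (c • C) i i) ht hX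
    (fun s hs => le_aeLimits (h.coloredNoise_mem hs i)) (h.ae_continuousOn_coloredNoise_apply i)
    (fun s hs _ => ?_) (h.integral_coloredNoise_mem ht i) (h.ae_integral_coloredNoise_apply ht i)
  rw [h.covariance_coloredNoise hs le_rfl, sub_self, flow_zero, one_mul]

lemma covariance_integral_integral_coloredNoise (h : IsDrivenNoise V B C c z₀ W μ) {s t : ℝ}
    (hs : 0 ≤ s) (ht : 0 ≤ t) (i j : Fin m) :
    cov[fun ω => (∫ u in (0 : ℝ)..s, coloredNoise B z₀ W u ω) i,
      fun ω => (∫ v in (0 : ℝ)..t, coloredNoise B z₀ W v ω) j; μ]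
      = ∫ u in (0 : ℝ)..s, ∫ v in (0 : ℝ)..t, twoTime (fun t => c • (flow B t * C)) u v i j := by
  rw [covariance_comm,
    h.covariance_integral_coloredNoise (h.integral_coloredNoise_mem ht j) hs]
  refine intervalIntegral.integral_congr fun u hu => ?_
  rw [uIcc_of_le hs] at hu
  rw [covariance_comm,
    h.covariance_integral_coloredNoise (le_aeLimits (h.coloredNoise_mem hu.1 i)) ht]
  refine intervalIntegral.integral_congr fun v hv => ?_
  rw [uIcc_of_le ht] at hv
  exact h.covariance_coloredNoise_eq_twoTime hu.1 hv.1 i j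

/-- The fluctuation-dissipation theorem: the white part of the noise contributes `D δ(t - t')`, the
colored part contributes its own correlation, and there are no cross terms. -/
lemma hasNoiseCorrelation_totalNoise (h : IsDrivenNoise V B C c z₀ W μ)
    (hW₁ : ∀ t, 0 ≤ t → ∀ i, (fun ω => W₁ t ω i) ∈ V) {D : Matrix (Fin m) (Fin m) ℝ}
    (hcov : ∀ s t, 0 ≤ s → 0 ≤ t → ∀ i j,
      cov[fun ω => W₁ s ω i, fun ω => W₁ t ω j; μ] = min s t * D i j)
    (hz : ∀ s, 0 ≤ s → ∀ i k, cov[fun ω => W₁ s ω i, fun ω => z₀ ω k; μ] = 0)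
    (hW : ∀ s t, 0 ≤ s → 0 ≤ t → ∀ i k, cov[fun ω => W₁ s ω i, fun ω => W t ω k; μ] = 0) :
    HasNoiseCorrelation (totalNoise W₁ (coloredNoise B z₀ W)) D
      (fun t => c • (flow B t * C)) μ := by
  intro s t hs ht i j
  have hV := h.gaussian.aeLimits.aeLimits
  have hmem : ∀ {r : ℝ}, 0 ≤ r → ∀ a, (fun ω => W₁ r ω a) ∈ aeLimits (aeLimits V μ) μ :=
    fun hr a => le_aeLimits (le_aeLimits (hW₁ _ hr a))
  have hcross : ∀ {r u : ℝ}, 0 ≤ r → 0 ≤ u → ∀ a b, cov[fun ω => W₁ r ω a,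
      fun ω => (∫ v in (0 : ℝ)..u, coloredNoise B z₀ W v ω) b; μ] = 0 := by
    intro r u hr hu a b
    rw [h.covariance_integral_coloredNoise (hmem hr a) hu]
    have h0 : ∫ v in (0 : ℝ)..u, cov[fun ω => W₁ r ω a, fun ω => coloredNoise B z₀ W v ω b; μ]
        = ∫ v in (0 : ℝ)..u, (0 : ℝ) := by
      refine intervalIntegral.integral_congr fun v hv => ?_
      rw [uIcc_of_le hu] at hv
      exact h.covariance_coloredNoise_eq_zero (hW₁ r hr a) (hz r hr a)
        (fun u hu k => hW r u hr hu a k) hv.1 b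
    rw [h0, intervalIntegral.integral_zero]
  have hM : ∀ {r : ℝ}, 0 ≤ r → ∀ a, MemLp (fun ω => W₁ r ω a) 2 μ := fun hr a =>
    (hV _ (hmem hr a)).memLp_two
  have hI : ∀ {r : ℝ}, 0 ≤ r → ∀ a,
      MemLp (fun ω => (∫ v in (0 : ℝ)..r, coloredNoise B z₀ W v ω) a) 2 μ := fun hr a =>
    (hV _ (h.integral_coloredNoise_mem hr a)).memLp_two
  have e1 := covariance_sub_left (hM hs i) (hI hs i) ((hM ht j).sub (hI ht j))
  have e2 := covariance_sub_right (hM hs i) (hM ht j) (hI ht j)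
  have e3 := covariance_sub_right (hI hs i) (hM ht j) (hI ht j)
  refine e1.trans ((congrArg₂ (· - ·) e2 e3).trans ?_)
  have e4 := (covariance_comm _ _).trans (hcross ht hs j i)
  rw [hcov s t hs ht, hcross hs ht, e4, h.covariance_integral_integral_coloredNoise hs ht]
  ring

end IsDrivenNoise

/-- A process whose coordinates at nonnegative times lie in a Gaussian space is a centered Gaussian
process. -/
lemma IsGaussianSpace.isCenteredGaussian (hV : IsGaussianSpace V μ) {X : ℝ → Ω → Fin m → ℝ}
    (hX : ∀ t, 0 ≤ t → ∀ i, (fun ω => X t ω i) ∈ V) : IsCenteredGaussian X μ where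
  gaussian := hV.isGaussianProcess fun t i => hX t t.2 i
  mean t ht i := (hV _ (hX t ht i)).integral_eq_zero

lemma IsWiener.covariance_eq {S : Matrix (Fin m) (Fin m) ℝ} (hW : IsWiener W S μ) {s t : ℝ}
    (hs : 0 ≤ s) (ht : 0 ≤ t) (i j : Fin m) :
    cov[fun ω => W s ω i, fun ω => W t ω j; μ] = min s t * S i j := by
  rw [hW.corr s t hs ht i j]
  simp [twoTime]

lemma IsCenteredGaussian.isGaussianSpace (hW : IsCenteredGaussian W μ) :
    IsGaussianSpace (coordSpan fun t : ℝ≥0 => W t) μ :=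
  isGaussianSpace_coordSpan hW.gaussian fun t i => hW.mean t t.2 i

lemma isGaussianProcess_const (hz : HasGaussianLaw z₀ μ) :
    IsGaussianProcess (fun _ : Unit => z₀) μ where
  hasGaussianLaw I :=
    hz.map (ContinuousLinearMap.pi fun _ : I => ContinuousLinearMap.id ℝ (Fin m → ℝ))

end TotalNoise

end CoarseGrain

/-! ### Equivalence of the models and the fluctuation-dissipation theorem -/

open CoarseGrain in
theorem theorem1 {d m k : ℕ} (hd : m + k = d)
    -- the full model and the orthogonal splitting of the configuration space
    (A Γ : Matrix (Fin d) (Fin d) ℝ) (hA : A.PosDef) (hΓ : Γ.PosSemidef)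
    (F : (Fin d → ℝ) → (Fin d → ℝ)) (hF : Continuous F)
    (Φ : Matrix (Fin d) (Fin m) ℝ) (Ψ : Matrix (Fin d) (Fin k) ℝ)
    (hΦ : Φᵀ * Φ = 1) (hΨ : Ψᵀ * Ψ = 1) (hΦΨ : Φᵀ * Ψ = 0)
    (kBT : ℝ) (hkBT : 0 < kBT)
    -- the moments exist, and the coefficients of the first-order model are defined
    (hθ : ∀ i j, IntegrableOn (fun t => memoryKernel A Γ Φ Ψ t i j) (Ioi 0))
    (hM : IsUnit (momentInfty A Γ Φ Ψ))
    (B C : Matrix (Fin m) (Fin m) ℝ)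
    (hC : C = momentZero A Γ Φ Ψ)
    (hB : B = -(momentZero A Γ Φ Ψ * (momentInfty A Γ Φ Ψ)⁻¹))
    -- the random data: `z(0)`, `f₁ = dW₁/dt` and `ζ = dW/dt`
    {Ω : Type*} [MeasurableSpace Ω] (μ : Measure Ω) [IsProbabilityMeasure μ]
    (z₀ : Ω → Fin m → ℝ) (hz₀ : HasGaussianLaw z₀ μ) (hz₀_mean : ∀ i, ∫ ω, z₀ ω i ∂μ = 0)
    (hz₀_cov : ∀ i j, cov[fun ω => z₀ ω i, fun ω => z₀ ω j; μ] = (kBT • C) i j)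
    (W : ℝ → Ω → Fin m → ℝ) (hW : IsWiener W (-(2 * kBT) • (C * Bᵀ)) μ)
    (W₁ : ℝ → Ω → Fin m → ℝ) (hW₁ : IsWiener W₁ ((2 * kBT) • (Φᵀ * Γ * Φ)) μ)
    (hind : IndepFun z₀ (fun ω (t : ℝ≥0) => W t ω) μ)
    (hind₁ : IndepFun (fun ω (t : ℝ≥0) => W₁ t ω)
      (fun ω => (z₀ ω, fun t : ℝ≥0 => W t ω)) μ) :
    -- the first-order model is the GLE with kernel `e^{Bt} C` and noise `f₁ - g`
    (∀ᵐ ω ∂μ, ∀ q p z : ℝ → Fin m → ℝ, z 0 = z₀ ω →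
      (SolvesFirstOrder (effectiveForce F A Φ Ψ) (Φᵀ * Γ * Φ) B C
          (fun t => W₁ t ω) (fun t => W t ω) q p z ↔
        SolvesGLE (effectiveForce F A Φ Ψ) (Φᵀ * Γ * Φ) (fun t => NormedSpace.exp (t • B) * C)
          (fun t => totalNoise W₁ (coloredNoise B z₀ W) t ω) q p ∧
        ∀ t, 0 ≤ t →
          z t = memoryTerm (fun t => NormedSpace.exp (t • B) * C) p t +
            coloredNoise B z₀ W t ω)) ∧
    -- the colored noise is a stationary centered Gaussian process with correlation
    -- `kBT e^{(t-t')B} C`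
    IsCenteredGaussian (coloredNoise B z₀ W) μ ∧
    IsStationary (coloredNoise B z₀ W) μ ∧
    (∀ t' t : ℝ, 0 ≤ t' → t' ≤ t → ∀ i j,
      cov[fun ω => coloredNoise B z₀ W t ω i, fun ω => coloredNoise B z₀ W t' ω j; μ] =
        (kBT • (NormedSpace.exp ((t - t') • B) * C)) i j) ∧
    -- the second fluctuation-dissipation theorem for the noise `f₁ - g` and the kernel `e^{Bt} C`
    IsCenteredGaussian (totalNoise W₁ (coloredNoise B z₀ W)) μ ∧
    HasNoiseCorrelation (totalNoise W₁ (coloredNoise B z₀ W)) ((2 * kBT) • (Φᵀ * Γ * Φ))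
      (fun t => kBT • (NormedSpace.exp (t • B) * C)) μ := by
  -- the spans of the coordinates of `W₁`, `z₀` and `W` are independent, so their sum is a Gaussian
  -- space
  have hz₀s : IsGaussianSpace (coordSpan fun _ : Unit => z₀) μ :=
    isGaussianSpace_coordSpan (isGaussianProcess_const hz₀) fun _ i => hz₀_mean i
  have hindzW : ∀ X ∈ coordSpan (fun _ : Unit => z₀), ∀ Y ∈ coordSpan (fun t : ℝ≥0 => W t),
      IndepFun X Y μ := by
    intro X hX Y hY
    obtain ⟨φ, hφ, rfl⟩ := exists_measurable_of_mem_coordSpan hX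
    obtain ⟨ψ, hψ, rfl⟩ := exists_measurable_of_mem_coordSpan hY
    exact hind.comp (φ := fun x => φ fun _ => x) (by fun_prop) hψ
  have hind₁zW : ∀ X ∈ coordSpan (fun t : ℝ≥0 => W₁ t),
      ∀ Y ∈ coordSpan (fun _ : Unit => z₀) ⊔ coordSpan (fun t : ℝ≥0 => W t), IndepFun X Y μ := by
    intro X hX Y hY
    obtain ⟨φ, hφ, rfl⟩ := exists_measurable_of_mem_coordSpan hX
    obtain ⟨Y₁, hY₁, Y₂, hY₂, rfl⟩ := Submodule.mem_sup.1 hY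
    obtain ⟨ψ₁, hψ₁, rfl⟩ := exists_measurable_of_mem_coordSpan hY₁
    obtain ⟨ψ₂, hψ₂, rfl⟩ := exists_measurable_of_mem_coordSpan hY₂
    exact hind₁.comp (ψ := fun x => ψ₁ (fun _ => x.1) + ψ₂ x.2) hφ (by fun_prop)
  have hzW := hz₀s.sup hW.isGaussianSpace hindzW
  have hV := hW₁.isGaussianSpace.sup hzW hind₁zW
  have hz_mem : ∀ i, (fun ω => z₀ ω i) ∈ coordSpan (fun _ : Unit => z₀) := fun i =>
    coord_mem_coordSpan (fun _ : Unit => z₀) () i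
  have hW_mem : ∀ t, 0 ≤ t → ∀ i, (fun ω => W t ω i) ∈ coordSpan (fun t : ℝ≥0 => W t) :=
    fun t ht i => coord_mem_coordSpan (fun t : ℝ≥0 => W t) ⟨t, ht⟩ i
  have hW₁_mem : ∀ t, 0 ≤ t → ∀ i, (fun ω => W₁ t ω i) ∈ coordSpan (fun t : ℝ≥0 => W₁ t) :=
    fun t ht i => coord_mem_coordSpan (fun t : ℝ≥0 => W₁ t) ⟨t, ht⟩ i
  have hcov₁ : ∀ X ∈ coordSpan (fun t : ℝ≥0 => W₁ t),
      ∀ Y ∈ coordSpan (fun _ : Unit => z₀) ⊔ coordSpan (fun t : ℝ≥0 => W t), cov[X, Y; μ] = 0 :=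
    fun X hX Y hY => (hind₁zW X hX Y hY).covariance_eq_zero
      (hW₁.isGaussianSpace X hX).memLp_two (hzW Y hY).memLp_two
  have h : IsDrivenNoise (coordSpan (fun t : ℝ≥0 => W₁ t) ⊔
      (coordSpan (fun _ : Unit => z₀) ⊔ coordSpan (fun t : ℝ≥0 => W t))) B C kBT z₀ W μ :=
    { gaussian := hV
      mul_eq := mul_eq_mul_transpose_of_moments hA hΓ hΨ hC hB
      symm := by rw [hC, momentZero_transpose hA hΓ hΨ]
      init_mem := fun i => Submodule.mem_sup_right (Submodule.mem_sup_left (hz_mem i))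
      mem := fun t ht i => Submodule.mem_sup_right (Submodule.mem_sup_right (hW_mem t ht i))
      cov_init := hz₀_cov
      cov_init_wiener := fun t ht i j =>
        (hindzW _ (hz_mem i) _ (hW_mem t ht j)).covariance_eq_zero
          (hz₀s _ (hz_mem i)).memLp_two (hW.isGaussianSpace _ (hW_mem t ht j)).memLp_two
      cov_wiener := fun s t hs ht i j => hW.covariance_eq hs ht i j
      start := hW.start
      cont := hW.cont }
  have hW₁_mem' : ∀ t, 0 ≤ t → ∀ i, (fun ω => W₁ t ω i) ∈ coordSpan (fun t : ℝ≥0 => W₁ t) ⊔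
      (coordSpan (fun _ : Unit => z₀) ⊔ coordSpan (fun t : ℝ≥0 => W t)) :=
    fun t ht i => Submodule.mem_sup_left (hW₁_mem t ht i)
  have hFeff : Continuous (effectiveForce F A Φ Ψ) := by
    unfold effectiveForce
    fun_prop
  refine ⟨?_, h.gaussian.aeLimits.isCenteredGaussian fun t ht i => h.coloredNoise_mem ht i,
    h.isStationary_coloredNoise, fun t' t ht' htt i j => h.covariance_coloredNoise ht' htt i j,
    h.gaussian.aeLimits.aeLimits.isCenteredGaussian fun t ht i => h.totalNoise_mem hW₁_mem' ht i,
    h.hasNoiseCorrelation_totalNoise hW₁_mem' (fun s t hs ht i j => hW₁.covariance_eq hs ht i j)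
      (fun s hs i k => hcov₁ _ (hW₁_mem s hs i) _ (Submodule.mem_sup_left (hz_mem k)))
      (fun s t hs ht i k => hcov₁ _ (hW₁_mem s hs i) _
        (Submodule.mem_sup_right (hW_mem t ht k)))⟩
  filter_upwards [hW.cont, h.ae_coloredNoise_eq] with ω hω hg q p z hz
  exact solvesFirstOrder_iff hFeff hω fun t ht => by rw [hg t ht, hz]
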